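/- For a real-rational matrix $H\in\mathbb{R}^{m\times n}(\xi)$ (not necessarily proper), let $\delta(H)$ denote its McMillan degree: the total number of poles of $H$ in $\mathbb{C}\cup\{\infty\}$, where each pole is counted with the largest multiplicity that it has as a pole of any minor of $H$. For a symmetric $H\in\mathbb{R}^{m\times m}(\xi)$, let $\gamma(H)$ denote its extended Cauchy index: the number of jumps of the eigenvalues of $H(\xi)$ from $-\infty$ to $+\infty$, less the number of jumps of the eigenvalues of $H(\xi)$ from $+\infty$ to $-\infty$, as $\xi$ increases from a point $a$ through $+\infty$ and then from $-\infty$ to $a$ again, for any $a\in\mathbb{R}$ that is not a pole of $H$. Let $H\in\mathbb{R}^{m\times m}(\xi)$ be symmetric, and let $S\in\mathbb{R}^{m\times n}$. Then $$\gamma(H)+\delta(H)\ \ge\ \gamma(S^{T}HS)-\delta(S^{T}HS)+2\,\delta(S^{T}H)$$ and $$\gamma(H)-\delta(H)\ \le\ \gamma(S^{T}HS)+\delta(S^{T}HS)-2\,\delta(S^{T}H).$$ -/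

import Mathlib

open Filter Topology Matrix Polynomial

noncomputable section

namespace RealRational

/-- Row and column selections that define the minors of an `m × n` matrix: a size
`k ≤ min m n` with `k` rows and `k` columns. Size `0` (the empty minor, equal to `1`) is allowed,
and a selection with a repeated row or column gives the value `0`; neither has a pole. -/
abbrev MinorIndex (m n : ℕ) : Type :=
  Σ k : Fin (min m n + 1), (Fin k → Fin m) × (Fin k → Fin n)

/-- The minor of `H` with the rows and columns selected by `s`. -/
def minor {m n : ℕ} (H : Matrix (Fin m) (Fin n) (RatFunc ℝ)) (s : MinorIndex m n) : RatFunc ℝ :=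
  (H.submatrix s.2.1 s.2.2).det

/-- The pole polynomial of `H`: the least common multiple of the (reduced) denominators of all
minors of `H`. The multiplicity of a complex number `z` as a root is the largest multiplicity
that `z` has as a pole of any minor of `H`. -/
def polePolynomial {m n : ℕ} (H : Matrix (Fin m) (Fin n) (RatFunc ℝ)) : ℝ[X] :=
  letI : NormalizedGCDMonoid ℝ[X] := UniqueFactorizationMonoid.toNormalizedGCDMonoid ℝ[X]
  (Finset.univ : Finset (MinorIndex m n)).lcm fun s => (minor H s).denom

/-- The multiplicity of infinity as a pole of `H`: the largest multiplicity that infinity has as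
a pole of any minor. A nonzero `f = p / q` has a pole of order `deg p - deg q` at infinity if this
is positive, and no pole at infinity otherwise. -/
def poleMultiplicityInfty {m n : ℕ} (H : Matrix (Fin m) (Fin n) (RatFunc ℝ)) : ℕ :=
  (Finset.univ : Finset (MinorIndex m n)).sup fun s => (minor H s).intDegree.toNat

/-- The McMillan degree of a (not necessarily proper) real-rational matrix: the total number of
its poles, in the finite complex plane and at infinity, each counted with the largest
multiplicity that it has as a pole of any minor. -/
def mcMillanDegree {m n : ℕ} (H : Matrix (Fin m) (Fin n) (RatFunc ℝ)) : ℕ :=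
  (polePolynomial H).natDegree + poleMultiplicityInfty H

/-- The real matrix `H(x)`; it is only meaningful if `x` is not a pole of `H`. -/
def evalAt {m n : ℕ} (H : Matrix (Fin m) (Fin n) (RatFunc ℝ)) (x : ℝ) :
    Matrix (Fin m) (Fin n) ℝ :=
  H.map fun f => f.eval (RingHom.id ℝ) x

theorem isHermitian_evalAt {m : ℕ} {H : Matrix (Fin m) (Fin m) (RatFunc ℝ)} (hH : H.IsSymm)
    (x : ℝ) : (evalAt H x).IsHermitian := by
  ext i j
  simp [evalAt, hH.apply i j]

/-- The `i`-th largest eigenvalue of `H(x)`, as a function of `x` (eigenvalues are repeated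
according to their multiplicity). -/
def eigenvalue {m : ℕ} (H : Matrix (Fin m) (Fin m) (RatFunc ℝ)) (hH : H.IsSymm)
    (i : Fin (Fintype.card (Fin m))) (x : ℝ) : ℝ :=
  (isHermitian_evalAt hH x).eigenvalues₀ i

open scoped Classical in
/-- The number of eigenvalues of `H(x)` that tend to `+∞` along the filter `l`. -/
def countToTop {m : ℕ} (H : Matrix (Fin m) (Fin m) (RatFunc ℝ)) (hH : H.IsSymm)
    (l : Filter ℝ) : ℕ :=
  (Finset.univ.filter fun i => Tendsto (eigenvalue H hH i) l atTop).card

/-- The finite set of real poles of `H`. -/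
def realPoles {m : ℕ} (H : Matrix (Fin m) (Fin m) (RatFunc ℝ)) : Finset ℝ :=
  Finset.univ.biUnion fun i => Finset.univ.biUnion fun j => (H i j).denom.roots.toFinset

/-- The net number of jumps of the eigenvalues of `H` from `-∞` to `+∞` (jumps from `-∞` to `+∞`
less jumps from `+∞` to `-∞`) at a point that is approached along `before` and left along `after`.
Each eigenvalue branch that is unbounded on one side of the point is unbounded on the other, so it
is of one of the types `(-∞, +∞)`, `(+∞, -∞)`, `(+∞, +∞)`, `(-∞, -∞)`. If there are `a`, `b`, `c`,
`d` of these, then `a + c` eigenvalues tend to `+∞` along `after` and `b + c` along `before`, and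
the difference is the net number `a - b` of jumps. -/
def netJumps {m : ℕ} (H : Matrix (Fin m) (Fin m) (RatFunc ℝ)) (hH : H.IsSymm)
    (before after : Filter ℝ) : ℤ :=
  (countToTop H hH after : ℤ) - (countToTop H hH before : ℤ)

/-- The extended Cauchy index of a symmetric real-rational matrix: the net number of jumps of the
eigenvalues from `-∞` to `+∞` as the argument runs once, in the increasing direction, around the
real line closed up at infinity. The jumps occur at the real poles (approached from the left, left
to the right) and at infinity (approached through `+∞`, left from `-∞`). -/
def extendedCauchyIndex {m : ℕ} (H : Matrix (Fin m) (Fin m) (RatFunc ℝ)) (hH : H.IsSymm) : ℤ :=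
  (∑ p ∈ realPoles H, netJumps H hH (𝓝[<] p) (𝓝[>] p)) + netJumps H hH atTop atBot

/-- A real matrix regarded as a constant real-rational matrix. -/
def const {m n : ℕ} (S : Matrix (Fin m) (Fin n) ℝ) : Matrix (Fin m) (Fin n) (RatFunc ℝ) :=
  S.map RatFunc.C

theorem isSymm_congruence {m n : ℕ} {H : Matrix (Fin m) (Fin m) (RatFunc ℝ)} (hH : H.IsSymm)
    (S : Matrix (Fin m) (Fin n) ℝ) : ((const S)ᵀ * H * const S).IsSymm := by
  simp only [Matrix.IsSymm, Matrix.transpose_mul, Matrix.transpose_transpose, hH.eq,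
    Matrix.mul_assoc]

end RealRational

end

/-! Both sides of each inequality are sums over the places of the projective line, and the
inequality holds place by place. At a place with local parameter `t` and residue field `K` (`ℝ` at
real points and at infinity, `ℂ` at the remaining points), the matrix `H` gives a symmetric pairing
on the lattice `K[[t]]ᵐ` with values in `K((t))`. Its coefficient of `t⁻¹` is a symmetric
`K`-bilinear form `β` of finite rank, the residue form.

Since `2` is invertible, the pairing has an orthogonal basis over `K[[t]]`
(`exists_orthogonal_basis`). In this basis `β` splits into residue forms of single Laurent series. A
series with a pole of order `N` and leading coefficient `c` contributes rank `N`, with equally many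
positive and negative squares except for one extra square of the sign of `c` when `N` is odd. The
sum of the pole orders is bounded by the largest pole order of a minor of `H`
(`exists_sum_poleOrder_le`), and over `ℝ` the signature is the net number of eigenvalue jumps
(`netJumps_zero`). So, with `π` and `ν` the numbers of positive and negative squares, `2π ≤ δ + γ`
and `2ν ≤ δ - γ` locally.

The residue form of `SᵀHS` is the pull-back of `β` along `S`, and the local degree of `SᵀH` is at
most the rank of `β ∘ S` (`poleOrder_minor_le_finrank`). The heart is a piece of linear algebra,
`finrank_range_comp_le_of_semidefinite`: `rank (β ∘ S) ≤ π(H) + ν(SᵀHS)`, because `β` is negative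
semidefinite in codimension `π(H)` while its pull-back is positive semidefinite in codimension
`ν(SᵀHS)`. Doubling gives the first inequality, and the same applied to `-H` gives the second. At
the other complex places there are no signs and no jumps, and `two_mul_finrank_range_comp_le` gives
`2 rank (β ∘ S) ≤ δ(H) + δ(SᵀHS)` locally.

The link between eigenvalues and the formal diagonalization is a polynomial truncation of the
orthogonal basis (`exists_polynomial_congruence`) combined with the min-max principle. Infinity is
moved to `0` by `-1/t`, which preserves the direction of travel. -/

noncomputable section

namespace RealRational

/-! ### Rank inequalities for symmetric forms of finite rank -/

section LinearAlgebra

open Module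

variable {K V U W : Type*} [Field K] [AddCommGroup V] [Module K V] [AddCommGroup U] [Module K U]
  [AddCommGroup W] [Module K W]

/-- A linear map that vanishes on the kernel of `f` factors through the range of `f`. -/
theorem exists_factor_range {f : V →ₗ[K] U} {g : V →ₗ[K] W}
    (h : LinearMap.ker f ≤ LinearMap.ker g) :
    ∃ k : LinearMap.range f →ₗ[K] W, ∀ v, k ⟨f v, v, rfl⟩ = g v := by
  obtain ⟨s, hs⟩ := f.rangeRestrict.exists_rightInverse_of_surjective f.range_rangeRestrict
  refine ⟨g ∘ₗ s, fun v => ?_⟩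
  have h1 : f.rangeRestrict (s (f.rangeRestrict v)) = f.rangeRestrict v :=
    LinearMap.congr_fun hs _
  have h2 : f (s (f.rangeRestrict v) - v) = 0 := by
    rw [map_sub, sub_eq_zero]; exact congrArg Subtype.val h1
  have h3 : g (s (f.rangeRestrict v) - v) = 0 := h h2
  rw [map_sub, sub_eq_zero] at h3
  exact h3

theorem finrank_range_le_of_ker_le {f : V →ₗ[K] U} {g : V →ₗ[K] W}
    [FiniteDimensional K (LinearMap.range f)] (h : LinearMap.ker f ≤ LinearMap.ker g) :
    FiniteDimensional K (LinearMap.range g) ∧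
      finrank K (LinearMap.range g) ≤ finrank K (LinearMap.range f) := by
  obtain ⟨k, hk⟩ := exists_factor_range h
  have : LinearMap.range g = LinearMap.range k := by
    ext w; constructor
    · rintro ⟨v, rfl⟩; exact ⟨_, hk v⟩
    · rintro ⟨⟨_, v, rfl⟩, rfl⟩; exact ⟨v, (hk v).symm⟩
  rw [this]
  exact ⟨inferInstance, LinearMap.finrank_range_le k⟩

theorem finrank_range_comp_le (f : V →ₗ[K] U) (g : W →ₗ[K] V)
    [FiniteDimensional K (LinearMap.range f)] :
    FiniteDimensional K (LinearMap.range (f ∘ₗ g)) ∧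
      finrank K (LinearMap.range (f ∘ₗ g)) ≤ finrank K (LinearMap.range f) :=
  ⟨Submodule.finiteDimensional_of_le (LinearMap.range_comp_le_range g f),
    Submodule.finrank_mono (LinearMap.range_comp_le_range g f)⟩

/-- The image of the kernel of a linear map into a space of dimension `q` loses at most `q`
dimensions. -/
theorem finrank_range_le_map_ker_add (f : V →ₗ[K] U) (g : V →ₗ[K] W)
    [FiniteDimensional K (LinearMap.range f)] [FiniteDimensional K W] :
    finrank K (LinearMap.range f) ≤
      finrank K ((LinearMap.ker g).map f) + finrank K W := by
  have hA : (LinearMap.ker g).map f ≤ LinearMap.range f := LinearMap.map_le_range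
  -- Modulo `f (ker g)` the map `f` kills `ker g`, so what is left of its range has dimension at
  -- most the rank of `g`.
  let q := ((LinearMap.ker g).map f).mkQ ∘ₗ f
  have hq : LinearMap.ker g ≤ LinearMap.ker q := by
    intro v hv
    simp only [q, LinearMap.mem_ker, LinearMap.comp_apply, Submodule.mkQ_apply,
      Submodule.Quotient.mk_eq_zero]
    exact ⟨v, hv, rfl⟩
  have h1 := (finrank_range_le_of_ker_le hq).2
  have h2 : finrank K (LinearMap.range g) ≤ finrank K W := Submodule.finrank_le _
  let r := ((LinearMap.ker g).map f).mkQ.domRestrict (LinearMap.range f)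
  have h3 := LinearMap.finrank_range_add_finrank_ker r
  have h4 : LinearMap.range r = LinearMap.range q := by
    rw [LinearMap.range_domRestrict, LinearMap.range_comp]
  have h5 : finrank K (LinearMap.ker r) ≤ finrank K ((LinearMap.ker g).map f) := by
    have : LinearMap.ker r = ((LinearMap.ker g).map f).comap (LinearMap.range f).subtype := by
      rw [LinearMap.ker_domRestrict, Submodule.ker_mkQ]
    rw [this]
    exact (Submodule.comapSubtypeEquivOfLe hA).finrank_eq.le
  rw [h4] at h3
  omega

theorem finrank_add_le_of_surjective [FiniteDimensional K U] (k : U →ₗ[K] W)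
    (hk : Function.Surjective k) (N : Submodule K U) (hN : ∀ x ∈ N, k x = 0) :
    finrank K N + finrank K W ≤ finrank K U := by
  have h1 := LinearMap.finrank_range_add_finrank_ker k
  rw [LinearMap.range_eq_top.2 hk, finrank_top] at h1
  have h2 := Submodule.finrank_mono (show N ≤ LinearMap.ker k from hN)
  omega

/-- Two subspaces whose images under a symmetric form meet only in functionals that vanish on both
subspaces have images of total dimension at most the rank of the form. -/
theorem finrank_map_add_finrank_map_le {β : V →ₗ[K] V →ₗ[K] K} (hβ : ∀ x y, β x y = β y x)
    [FiniteDimensional K (LinearMap.range β)] (A B : Submodule K V)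
    (h : ∀ a ∈ A, ∀ b ∈ B, β a = β b → (∀ a' ∈ A, β a a' = 0) ∧ ∀ b' ∈ B, β a b' = 0) :
    finrank K (A.map β) + finrank K (B.map β) ≤ finrank K (LinearMap.range β) := by
  have hA : A.map β ≤ LinearMap.range β := LinearMap.map_le_range
  have hB : B.map β ≤ LinearMap.range β := LinearMap.map_le_range
  have := Submodule.finiteDimensional_of_le hA
  have := Submodule.finiteDimensional_of_le hB
  set Z := A.map β ⊓ B.map β with hZ
  have hZf : FiniteDimensional K Z := Submodule.finiteDimensional_of_le (inf_le_left : Z ≤ A.map β)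
  rw [← Submodule.finrank_sup_add_finrank_inf_eq, ← hZ]
  -- Evaluation of the functionals in `Z`. By symmetry it factors through `β` as a surjection from
  -- the range of `β` onto the dual of `Z`. The hypothesis says that this surjection kills `β A + β
  -- B`, so `dim (β A + β B) + dim Z ≤ rank β`.
  let ψ : V →ₗ[K] Dual K Z := Z.subtype.flip
  have hψ : Function.Surjective ψ := fun d => by
    let B' : Z →ₗ[K] V →ₗ[K] K := Z.subtype
    have hB' : Function.Injective B' := Subtype.val_injective
    have h := (LinearMap.flip_surjective_iff₁ (K := K) (V₁ := Z) (V₂ := V) (B := B')).2 hB'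
    exact h d
  have hker : LinearMap.ker β ≤ LinearMap.ker ψ := by
    intro v hv
    rw [LinearMap.mem_ker] at hv ⊢
    ext ⟨_, ⟨a, ha, rfl⟩, _⟩
    change β a v = 0
    rw [hβ, hv]; rfl
  obtain ⟨k, hk⟩ := exists_factor_range hker
  have hks : Function.Surjective k := fun d => by
    obtain ⟨v, rfl⟩ := hψ d
    exact ⟨_, hk v⟩
  have h0 : finrank K (Dual K Z) = finrank K Z := Subspace.dual_finrank_eq (K := K) (V := Z)
  have h3 := finrank_add_le_of_surjective (U := LinearMap.range β) (W := Dual K Z) k hks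
    ((A.map β ⊔ B.map β).comap (LinearMap.range β).subtype) (by
      rintro ⟨_, v, rfl⟩ hv
      rw [Submodule.mem_comap, ← Submodule.map_sup] at hv
      obtain ⟨w, hw, hwv⟩ := hv
      obtain ⟨a, ha, b, hb, rfl⟩ := Submodule.mem_sup.1 hw
      have hwv' : (⟨β v, v, rfl⟩ : LinearMap.range β) = ⟨β (a + b), a + b, rfl⟩ :=
        Subtype.ext hwv.symm
      rw [hwv', hk]
      ext ⟨_, ⟨a', ha', rfl⟩, b', hb', hab⟩
      change β a' (a + b) = 0
      obtain ⟨h3, h4⟩ := h a' ha' b' hb' hab.symm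
      rw [map_add, h3 a ha, h4 b hb, add_zero])
  rw [(Submodule.comapSubtypeEquivOfLe (sup_le hA hB)).finrank_eq] at h3
  omega

/-- An isotropic vector of a semidefinite form is in its radical. -/
theorem eq_zero_of_semidefinite [LinearOrder K] [IsStrictOrderedRing K] {β : V →ₗ[K] V →ₗ[K] K}
    (hβ : ∀ x y, β x y = β y x) {A : Submodule K V} (hA : ∀ a ∈ A, 0 ≤ β a a) {a : V} (ha : a ∈ A)
    (h0 : β a a = 0) {b : V} (hb : b ∈ A) : β a b = 0 := by
  have key : ∀ t : K, 0 ≤ 2 * t * β a b + t ^ 2 * β b b + 0 := fun t => by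
    have := hA (a + t • b) (A.add_mem ha (A.smul_mem t hb))
    simp only [map_add, map_smul, LinearMap.add_apply, LinearMap.smul_apply, smul_eq_mul, h0,
      hβ b a] at this
    nlinarith
  have hbb := hA b hb
  by_contra hne
  -- Near the minimizer `-β a b / β b b`; the `+ 1` keeps the denominator positive even when `β b b
  -- = 0`.
  have h1 := key (-(β a b) / (β b b + 1))
  have hp : 0 < β b b + 1 := by linarith
  have h2 : 2 * (-(β a b) / (β b b + 1)) * β a b + (-(β a b) / (β b b + 1)) ^ 2 * β b b + 0 =
      -(β a b) ^ 2 * (β b b + 2) / (β b b + 1) ^ 2 := by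
    field_simp; ring
  rw [h2] at h1
  have h3 : 0 < (β a b) ^ 2 * (β b b + 2) / (β b b + 1) ^ 2 := by positivity
  have h4 : -(β a b) ^ 2 * (β b b + 2) / (β b b + 1) ^ 2 =
    -((β a b) ^ 2 * (β b b + 2) / (β b b + 1) ^ 2) := by ring
  linarith

/-- If `β` is negative semidefinite on a subspace of codimension at most `p` and its pull-back
along `S` is positive semidefinite on a subspace of codimension at most `q`, then `x ↦ β (S x)`
has rank at most `p + q`. -/
theorem finrank_range_comp_le_of_semidefinite [LinearOrder K] [IsStrictOrderedRing K]
    {P Q : Type*} [AddCommGroup P] [Module K P] [AddCommGroup Q] [Module K Q]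
    [FiniteDimensional K P] [FiniteDimensional K Q] {β : V →ₗ[K] V →ₗ[K] K}
    (hβ : ∀ x y, β x y = β y x) [FiniteDimensional K (LinearMap.range β)] (S : U →ₗ[K] V)
    (f : V →ₗ[K] P) (g : U →ₗ[K] Q) (hf : ∀ x, f x = 0 → β x x ≤ 0)
    (hg : ∀ u, g u = 0 → 0 ≤ β (S u) (S u)) :
    finrank K (LinearMap.range (β ∘ₗ S)) ≤ finrank K P + finrank K Q := by
  have := (finrank_range_comp_le β S).1
  have h1 := finrank_range_le_map_ker_add β f
  have h2 := finrank_range_le_map_ker_add (β ∘ₗ S) g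
  rw [Submodule.map_comp] at h2
  have hpos : ∀ b ∈ (LinearMap.ker g).map S, 0 ≤ β b b := by
    rintro _ ⟨u, hu, rfl⟩
    exact hg u hu
  have hneg : ∀ a ∈ LinearMap.ker f, 0 ≤ (-β) a a := fun a ha => by
    simpa using hf a ha
  -- If `β a = β b` with `a` in the negative and `b` in the positive subspace, then `β a a = β b b`
  -- is both `≤ 0` and `≥ 0`. Hence `a` and `b` are isotropic in semidefinite subspaces, and the
  -- common functional vanishes on both.
  have h3 := finrank_map_add_finrank_map_le hβ (LinearMap.ker f) ((LinearMap.ker g).map S) (by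
    intro a ha b hb hab
    have e1 : β a a = β b b := by rw [hab, hβ, hab]
    have e2 : β a a ≤ 0 := hf a ha
    have e3 := hpos b hb
    have e4 : β a a = 0 := by linarith
    refine ⟨fun a' ha' => ?_, fun b' hb' => ?_⟩
    · have := eq_zero_of_semidefinite (β := -β) (fun x y => by simp [hβ x y]) hneg ha
        (by simp [e4]) ha'
      simpa using this
    · rw [hab]
      exact eq_zero_of_semidefinite hβ hpos hb (e1 ▸ e4) hb')
  omega

/-- The version without signs, needed over `ℂ`. The functionals in `β (S (ker g))` vanish on the
range of `S`, so the images of `range S` and `S (ker g)` have total dimension at most `rank β ≤ dim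
P`. Passing from `range S` to `S (ker g)` costs at most `dim Q`, whence the factor `2`. -/
theorem two_mul_finrank_range_comp_le {P Q : Type*} [AddCommGroup P] [Module K P]
    [AddCommGroup Q] [Module K Q] [FiniteDimensional K P] [FiniteDimensional K Q]
    {β : V →ₗ[K] V →ₗ[K] K} (hβ : ∀ x y, β x y = β y x) (S : U →ₗ[K] V)
    (f : V →ₗ[K] P) (g : U →ₗ[K] Q) (hf : ∀ x, f x = 0 → β x = 0)
    (hg : ∀ u, g u = 0 → ∀ u', β (S u) (S u') = 0) :
    2 * finrank K (LinearMap.range (β ∘ₗ S)) ≤ finrank K P + finrank K Q := by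
  obtain ⟨hfin, h0⟩ := finrank_range_le_of_ker_le (f := f) (g := β) hf
  have h0' : finrank K (LinearMap.range f) ≤ finrank K P := Submodule.finrank_le _
  have := (finrank_range_comp_le β S).1
  have h2 := finrank_range_le_map_ker_add (β ∘ₗ S) g
  rw [Submodule.map_comp] at h2
  have h3 := finrank_map_add_finrank_map_le hβ (LinearMap.range S) ((LinearMap.ker g).map S) (by
    rintro a ⟨u, rfl⟩ _ ⟨u', hu', rfl⟩ hab
    have hz : ∀ u'', β (S u) (S u'') = 0 := fun u'' => by rw [hab]; exact hg u' hu' u''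
    refine ⟨?_, ?_⟩
    · rintro _ ⟨u'', rfl⟩; exact hz u''
    · rintro _ ⟨u'', -, rfl⟩; exact hz u'')
  rw [← LinearMap.range_comp] at h3
  omega

end LinearAlgebra

/-! ### Diagonalization of forms and pairings over a discrete valuation ring -/

section ValuationRing

open Module

variable {R F : Type*} [CommRing R] [Field F] [Algebra R F]

theorem Basis.apply_eq_smul {M N : Type*} [AddCommGroup M] [Module R M] [AddCommGroup N]
    [Module R N] {ι κ : Type*} (b : Basis ι R M) (c : Basis κ R N) (B : M →ₗ[R] N →ₗ[R] F) (f : F)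
    (h : ∀ i j, ∃ r : R, B (b i) (c j) = r • f) (x : M) (y : N) : ∃ r : R, B x y = r • f := by
  have h1 : ∀ i, (⊤ : Submodule R N) ≤ (R ∙ f).comap (B (b i)) := fun i => by
    rw [← c.span_eq, Submodule.span_le]
    rintro _ ⟨j, rfl⟩
    obtain ⟨r, hr⟩ := h i j
    exact Submodule.mem_span_singleton.2 ⟨r, hr.symm⟩
  have h2 : (⊤ : Submodule R M) ≤ (R ∙ f).comap (B.flip y) := by
    rw [← b.span_eq, Submodule.span_le]
    rintro _ ⟨i, rfl⟩
    exact h1 i (Submodule.mem_top (x := y))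
  obtain ⟨r, hr⟩ := Submodule.mem_span_singleton.1 (h2 (Submodule.mem_top (x := x)))
  exact ⟨r, hr.symm⟩

variable [IsFractionRing R F]

variable (R) in
/-- Among finitely many elements of the fraction field of a valuation ring, one divides all. -/
theorem exists_forall_eq_smul [IsDomain R] [ValuationRing R] {ι : Type*} [Finite ι]
    [Nonempty ι] (g : ι → F) :
    ∃ i, ∀ j, ∃ r : R, g j = r • g i := by
  obtain ⟨i, hi⟩ := Finite.exists_max fun i => ValuationRing.valuation R F (g i)
  refine ⟨i, fun j => ?_⟩
  by_cases h0 : g i = 0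
  · have := hi j
    rw [h0, map_zero, le_zero_iff, map_eq_zero] at this
    exact ⟨0, by simp [this]⟩
  · have h1 : ValuationRing.valuation R F (g j / g i) ≤ 1 := by
      rw [map_div₀]
      exact div_le_one_of_le₀ (hi j) zero_le
    obtain ⟨r, hr⟩ := (ValuationRing.mem_integer_iff R F _).1 h1
    exact ⟨r, by rw [Algebra.smul_def, hr, div_mul_cancel₀ _ h0]⟩

/-- Splitting off a vector `x` with respect to a functional that is maximal at `x`. -/
theorem exists_basis_cons {M : Type*} [AddCommGroup M] [Module R M] {d : ℕ} (φ : M →ₗ[R] F)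
    (x : M) (hx : φ x ≠ 0) (h : ∀ y, ∃ r : R, φ y = r • φ x)
    (b : Basis (Fin d) R (LinearMap.ker φ)) :
    ∃ b' : Basis (Fin (d + 1)) R M, b' 0 = x ∧ ∀ i : Fin d, b' i.succ = b i := by
  refine ⟨Basis.mkFinCons x b ?_ ?_, ?_, fun i => ?_⟩
  · intro c y hy hc
    have := congrArg φ hc
    rw [map_add, map_smul, LinearMap.mem_ker.1 hy, add_zero, map_zero, Algebra.smul_def,
      mul_eq_zero, or_iff_left hx] at this
    exact (map_eq_zero_iff _ (IsFractionRing.injective R F)).1 this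
  · intro z
    obtain ⟨r, hr⟩ := h z
    exact ⟨-r, by rw [LinearMap.mem_ker, map_add, map_smul, hr, neg_smul, add_neg_cancel]⟩
  · rw [Basis.coe_mkFinCons]; rfl
  · rw [Basis.coe_mkFinCons]; rfl

/-- A symmetric bilinear form on a free module over a discrete valuation ring in which `2` is
invertible, with values in the fraction field, has an orthogonal basis. -/
theorem exists_orthogonal_basis [IsDomain R] [ValuationRing R] [IsPrincipalIdealRing R]
    (h2 : IsUnit (2 : R)) (d : ℕ) {M : Type*} [AddCommGroup M]
    [Module R M] [Module.Free R M] [Module.Finite R M] (hd : finrank R M = d)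
    (B : M →ₗ[R] M →ₗ[R] F) (hB : ∀ x y, B x y = B y x) :
    ∃ b : Basis (Fin d) R M, ∀ i j, i ≠ j → B (b i) (b j) = 0 := by
  induction d generalizing M with
  | zero => exact ⟨finBasisOfFinrankEq R M hd, fun i => i.elim0⟩
  | succ d ih =>
    let e := finBasisOfFinrankEq R M hd
    -- Polarization: as `2` is a unit, the numbers `B (eᵢ + eⱼ) (eᵢ + eⱼ)`, with `i = j` allowed,
    -- generate all values of `B`. The one that divides the others gives a vector `x` such that `B x
    -- x` divides every value, so `x` can be split off.
    obtain ⟨⟨p, q⟩, hpq⟩ := exists_forall_eq_smul R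
      (fun p : Fin (d + 1) × Fin (d + 1) => B (e p.1 + e p.2) (e p.1 + e p.2))
    set x := e p + e q with hx
    obtain ⟨u, hu⟩ := h2
    have hu' : ∀ f : F, f = (↑u⁻¹ : R) • ((2 : F) * f) := fun f => by
      have : (2 : F) * f = (u : R) • f := by
        rw [hu, Algebra.smul_def, map_ofNat]
      rw [this, smul_smul, Units.inv_mul, one_smul]
    have hdiag : ∀ i, ∃ r : R, B (e i) (e i) = r • B x x := fun i => by
      obtain ⟨r, hr⟩ := hpq (i, i)
      refine ⟨↑u⁻¹ * (↑u⁻¹ * r), ?_⟩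
      rw [mul_smul, mul_smul, ← hr, hu' (B (e i) (e i)), hu' (2 * B (e i) (e i))]
      congr 2
      simp only [map_add, LinearMap.add_apply]
      ring
    have hall : ∀ y z, ∃ r : R, B y z = r • B x x := by
      apply Basis.apply_eq_smul e e
      intro i j
      obtain ⟨r, hr⟩ := hpq (i, j)
      obtain ⟨s, hs⟩ := hdiag i
      obtain ⟨t, ht⟩ := hdiag j
      refine ⟨↑u⁻¹ * (r - s - t), ?_⟩
      rw [mul_smul, sub_smul, sub_smul, ← hr, ← hs, ← ht, hu' (B (e i) (e j))]
      congr 1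
      simp only [map_add, LinearMap.add_apply]
      rw [hB (e j) (e i)]
      ring
    by_cases h0 : B x x = 0
    · exact ⟨e, fun i j _ => by
        obtain ⟨r, hr⟩ := hall (e i) (e j)
        rw [hr, h0, smul_zero]⟩
    -- This basis only serves to compute the rank of the orthogonal complement of `x`.
    · obtain ⟨b₁, -⟩ := exists_basis_cons (B x) x h0 (hall x) (finBasis R (LinearMap.ker (B x)))
      have hd' : finrank R (LinearMap.ker (B x)) = d := by
        have := finrank_eq_card_basis b₁
        rw [Fintype.card_fin] at this
        omega
      obtain ⟨b₂, hb₂⟩ := ih hd' ((B.domRestrict (LinearMap.ker (B x))).compl₂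
        (LinearMap.ker (B x)).subtype) (fun y z => hB _ _)
      obtain ⟨b, hb0, hbs⟩ := exists_basis_cons (B x) x h0 (hall x) b₂
      refine ⟨b, fun i j hij => ?_⟩
      induction i using Fin.cases with
      | zero =>
        induction j using Fin.cases with
        | zero => exact absurd rfl hij
        | succ j =>
          rw [hb0, hbs]
          exact (b₂ j).2
      | succ i =>
        induction j using Fin.cases with
        | zero =>
          rw [hb0, hbs, hB]
          exact (b₂ i).2
        | succ j =>
          rw [hbs, hbs]
          exact hb₂ i j fun h => hij (congrArg _ h)

/-- A pairing of free modules of the same rank over a discrete valuation ring, with values in the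
fraction field, is diagonal in suitable bases. -/
theorem exists_diagonalizing_bases [IsDomain R] [ValuationRing R] [IsPrincipalIdealRing R]
    (d : ℕ) {M N : Type*} [AddCommGroup M]
    [Module R M] [Module.Free R M] [Module.Finite R M] [AddCommGroup N]
    [Module R N] [Module.Free R N] [Module.Finite R N] (hM : finrank R M = d) (hN : finrank R N = d)
    (B : M →ₗ[R] N →ₗ[R] F) :
    ∃ (b : Basis (Fin d) R M) (c : Basis (Fin d) R N), ∀ i j, i ≠ j → B (b i) (c j) = 0 := by
  induction d generalizing M N with
  | zero => exact ⟨finBasisOfFinrankEq R M hM, finBasisOfFinrankEq R N hN, fun i => i.elim0⟩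
  | succ d ih =>
    let e := finBasisOfFinrankEq R M hM
    let f := finBasisOfFinrankEq R N hN
    obtain ⟨⟨p, q⟩, hpq⟩ := exists_forall_eq_smul R
      (fun p : Fin (d + 1) × Fin (d + 1) => B (e p.1) (f p.2))
    set x := e p with hx
    set w := f q with hw
    have hall : ∀ y z, ∃ r : R, B y z = r • B x w :=
      Basis.apply_eq_smul e f B _ fun i j => hpq (i, j)
    by_cases h0 : B x w = 0
    · exact ⟨e, f, fun i j _ => by
        obtain ⟨r, hr⟩ := hall (e i) (f j)
        rw [hr, h0, smul_zero]⟩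
    · obtain ⟨b₁, -⟩ := exists_basis_cons (B.flip w) x h0 (fun y => hall y w)
        (finBasis R (LinearMap.ker (B.flip w)))
      obtain ⟨c₁, -⟩ := exists_basis_cons (B x) w h0 (hall x) (finBasis R (LinearMap.ker (B x)))
      have hM' : finrank R (LinearMap.ker (B.flip w)) = d := by
        have := finrank_eq_card_basis b₁
        rw [Fintype.card_fin] at this
        omega
      have hN' : finrank R (LinearMap.ker (B x)) = d := by
        have := finrank_eq_card_basis c₁
        rw [Fintype.card_fin] at this
        omega
      obtain ⟨b₂, c₂, hb₂⟩ := ih hM' hN' ((B.domRestrict (LinearMap.ker (B.flip w))).compl₂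
        (LinearMap.ker (B x)).subtype)
      obtain ⟨b, hb0, hbs⟩ := exists_basis_cons (B.flip w) x h0 (fun y => hall y w) b₂
      obtain ⟨c, hc0, hcs⟩ := exists_basis_cons (B x) w h0 (hall x) c₂
      refine ⟨b, c, fun i j hij => ?_⟩
      induction i using Fin.cases with
      | zero =>
        induction j using Fin.cases with
        | zero => exact absurd rfl hij
        | succ j =>
          rw [hb0, hcs]
          exact (c₂ j).2
      | succ i =>
        induction j using Fin.cases with
        | zero =>
          rw [hc0, hbs]
          exact (b₂ i).2
        | succ j =>
          rw [hbs, hcs]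
          exact hb₂ i j fun h => hij (congrArg _ h)

end ValuationRing

/-! ### Pole orders of Laurent series and the residue form -/

section Laurent

open Module HahnSeries

variable {K : Type*} [Field K]

theorem C_smul_laurentSeries (a : K) (f : LaurentSeries K) : PowerSeries.C a • f = a • f := by
  rw [Algebra.smul_def, LaurentSeries.coe_algebraMap, HahnSeries.ofPowerSeries_C,
    HahnSeries.C_mul_eq_smul]

theorem X_pow_smul_laurentSeries (n : ℕ) (f : LaurentSeries K) :
    (PowerSeries.X ^ n : PowerSeries K) • f = single (n : ℤ) 1 * f := by
  rw [Algebra.smul_def, LaurentSeries.coe_algebraMap, HahnSeries.ofPowerSeries_X_pow]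

theorem coeff_X_pow_smul (n : ℕ) (f : LaurentSeries K) (i : ℤ) :
    ((PowerSeries.X ^ n : PowerSeries K) • f).coeff i = f.coeff (i - n) := by
  rw [X_pow_smul_laurentSeries, HahnSeries.coeff_single_mul, one_mul]

/-- The order of the pole at `0` of a Laurent series. -/
def poleOrder (f : LaurentSeries K) : ℕ := (-f.order).toNat

@[simp]
theorem poleOrder_zero : poleOrder (0 : LaurentSeries K) = 0 := by simp [poleOrder]

theorem poleOrder_le_iff_coeff {f : LaurentSeries K} {N : ℕ} :
    poleOrder f ≤ N ↔ ∀ n < -(N : ℤ), f.coeff n = 0 := by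
  constructor
  · intro h n hn
    apply HahnSeries.coeff_eq_zero_of_lt_order
    unfold poleOrder at h
    omega
  · intro h
    by_cases h0 : f = 0
    · simp [h0]
    · have h1 := mt HahnSeries.coeff_order_eq_zero.1 h0
      have h2 : ¬ f.order < -(N : ℤ) := fun h3 => h1 (h _ h3)
      unfold poleOrder
      omega

theorem exists_powerSeries_iff {f : LaurentSeries K} :
    (∃ r, algebraMap (PowerSeries K) (LaurentSeries K) r = f) ↔ ∀ n < 0, f.coeff n = 0 := by
  constructor
  · rintro ⟨r, rfl⟩ n hn
    rw [LaurentSeries.coe_algebraMap, PowerSeries.coeff_coe, if_pos hn]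
  · intro h
    refine ⟨PowerSeries.mk fun n => f.coeff n, ?_⟩
    ext n
    rw [LaurentSeries.coe_algebraMap, PowerSeries.coeff_coe]
    split_ifs with hn
    · exact (h n hn).symm
    · rw [PowerSeries.coeff_mk]
      congr 1
      omega

variable (K) in
/-- The Laurent series that have a pole of order at most `N`. -/
def polesLE (N : ℕ) : Submodule (PowerSeries K) (LaurentSeries K) :=
  (LinearMap.range (Algebra.linearMap (PowerSeries K) (LaurentSeries K))).comap
    (LinearMap.lsmul (PowerSeries K) (LaurentSeries K) (PowerSeries.X ^ N))

theorem mem_polesLE {N : ℕ} {f : LaurentSeries K} :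
    f ∈ polesLE K N ↔ ∃ r : PowerSeries K,
      algebraMap _ (LaurentSeries K) r = (PowerSeries.X ^ N : PowerSeries K) • f := Iff.rfl

theorem mem_polesLE_iff {N : ℕ} {f : LaurentSeries K} : f ∈ polesLE K N ↔ poleOrder f ≤ N := by
  rw [mem_polesLE, exists_powerSeries_iff, poleOrder_le_iff_coeff]
  constructor
  · intro h n hn
    have := h (n + N) (by omega)
    rwa [coeff_X_pow_smul, add_sub_cancel_right] at this
  · intro h n hn
    rw [coeff_X_pow_smul]
    exact h _ (by omega)

theorem mem_polesLE_poleOrder (f : LaurentSeries K) : f ∈ polesLE K (poleOrder f) :=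
  mem_polesLE_iff.2 le_rfl

theorem prod_mem_polesLE {ι : Type*} (s : Finset ι) (f : ι → LaurentSeries K) (p : ι → ℕ)
    (h : ∀ i ∈ s, f i ∈ polesLE K (p i)) : ∏ i ∈ s, f i ∈ polesLE K (∑ i ∈ s, p i) := by
  classical
  induction s using Finset.induction_on with
  | empty => exact ⟨1, by simp⟩
  | insert a s ha ih =>
    rw [Finset.prod_insert ha, Finset.sum_insert ha]
    obtain ⟨r, hr⟩ := mem_polesLE.1 (h a (Finset.mem_insert_self a s))
    obtain ⟨t, ht⟩ := mem_polesLE.1 (ih fun i hi => h i (Finset.mem_insert_of_mem hi))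
    exact mem_polesLE.2 ⟨r * t, by rw [map_mul, hr, ht, _root_.pow_add, smul_mul_smul_comm]⟩

/-- Orders add under multiplication, so `r` has to cancel the whole pole of `f`. -/
theorem X_pow_dvd_of_smul_regular {f : LaurentSeries K} {r : PowerSeries K}
    (h : ∀ n < 0, (r • f).coeff n = 0) : PowerSeries.X ^ poleOrder f ∣ r := by
  by_cases hr : r = 0
  · simp [hr]
  by_cases hf : f = 0
  · simp [hf]
  rw [PowerSeries.X_pow_dvd_iff]
  intro m hm
  have hr' : algebraMap (PowerSeries K) (LaurentSeries K) r ≠ 0 :=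
    (map_ne_zero_iff _ (IsFractionRing.injective _ _)).2 hr
  have h1 : (r • f).order = (algebraMap (PowerSeries K) (LaurentSeries K) r).order + f.order := by
    rw [Algebra.smul_def, HahnSeries.order_mul hr' hf]
  have h2 : 0 ≤ (r • f).order := by
    by_contra h3
    have := h _ (not_le.1 h3)
    rw [HahnSeries.coeff_order_eq_zero, Algebra.smul_def, mul_eq_zero] at this
    exact this.elim hr' hf
  rw [← LaurentSeries.coeff_coe_powerSeries, ← LaurentSeries.coe_algebraMap]
  apply HahnSeries.coeff_eq_zero_of_lt_order
  unfold poleOrder at hm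
  omega

/-- The residue of a pairing of `K[[t]]`-modules with values in `K((t))`. -/
def residueForm {M N : Type*} [AddCommGroup M] [Module (PowerSeries K) M] [Module K M]
    [IsScalarTower K (PowerSeries K) M] [AddCommGroup N] [Module (PowerSeries K) N] [Module K N]
    [IsScalarTower K (PowerSeries K) N]
    (B : M →ₗ[PowerSeries K] N →ₗ[PowerSeries K] LaurentSeries K) : M →ₗ[K] N →ₗ[K] K :=
  LinearMap.mk₂ K (fun x y => (B x y).coeff (-1))
    (fun x x' y => by simp)
    (fun a x y => by
      rw [← algebraMap_smul (PowerSeries K) a x, map_smul, LinearMap.smul_apply,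
        ← PowerSeries.C_eq_algebraMap, C_smul_laurentSeries, HahnSeries.coeff_smul])
    (fun x y y' => by simp)
    (fun a x y => by
      rw [← algebraMap_smul (PowerSeries K) a y, map_smul,
        ← PowerSeries.C_eq_algebraMap, C_smul_laurentSeries, HahnSeries.coeff_smul])

section Form

variable {M N : Type*} [AddCommGroup M] [Module (PowerSeries K) M] [Module K M]
    [IsScalarTower K (PowerSeries K) M] [AddCommGroup N] [Module (PowerSeries K) N] [Module K N]
    [IsScalarTower K (PowerSeries K) N] {ι : Type*} [Fintype ι]

@[simp]
theorem residueForm_apply (B : M →ₗ[PowerSeries K] N →ₗ[PowerSeries K] LaurentSeries K) (x : M)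
    (y : N) : residueForm B x y = (B x y).coeff (-1) := rfl

/-- The first `p i` coefficients of the `i`-th coordinate with respect to a basis. -/
def truncation (b : Basis ι (PowerSeries K) M) (p : ι → ℕ) : M →ₗ[K] (Σ i, Fin (p i)) → K where
  toFun x := fun s => PowerSeries.coeff (s.2 : ℕ) (b.repr x s.1)
  map_add' x y := by ext; simp
  map_smul' a x := by
    ext s
    rw [← algebraMap_smul (PowerSeries K) a x, map_smul]
    simp

omit [Fintype ι] in
theorem truncation_eq_zero_iff (b : Basis ι (PowerSeries K) M) (p : ι → ℕ) (x : M) :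
    truncation b p x = 0 ↔ ∀ i, PowerSeries.X ^ p i ∣ b.repr x i := by
  simp only [PowerSeries.X_pow_dvd_iff]
  constructor
  · intro h i m hm
    exact congrFun h ⟨i, m, hm⟩
  · intro h
    ext ⟨i, m⟩
    exact h i m m.2

theorem truncation_surjective (b : Basis ι (PowerSeries K) M) (p : ι → ℕ) :
    Function.Surjective (truncation b p) := by
  intro v
  refine ⟨b.equivFun.symm fun i => PowerSeries.mk fun m => if h : m < p i then v ⟨i, m, h⟩ else 0,
    ?_⟩
  ext ⟨i, m⟩
  change PowerSeries.coeff (m : ℕ) (b.equivFun (b.equivFun.symm _) i) = _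
  rw [LinearEquiv.apply_symm_apply, PowerSeries.coeff_mk, dif_pos m.2]

theorem finrank_truncation_target (p : ι → ℕ) :
    finrank K ((Σ i, Fin (p i)) → K) = ∑ i, p i := by
  simp

omit [Module K M] [IsScalarTower K (PowerSeries K) M] [Module K N]
  [IsScalarTower K (PowerSeries K) N] in
theorem apply_eq_sum_of_diagonal {b : Basis ι (PowerSeries K) M} {c : Basis ι (PowerSeries K) N}
    {B : M →ₗ[PowerSeries K] N →ₗ[PowerSeries K] LaurentSeries K}
    (h : ∀ i j, i ≠ j → B (b i) (c j) = 0) (x : M) (y : N) :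
    B x y = ∑ i, (b.repr x i * c.repr y i) • B (b i) (c i) := by
  conv_lhs => rw [← b.sum_repr x, ← c.sum_repr y]
  simp only [map_sum, LinearMap.sum_apply, map_smul, LinearMap.smul_apply]
  refine Finset.sum_congr rfl fun i _ => ?_
  rw [Finset.sum_eq_single i (fun j _ hj => by rw [h j i hj, smul_zero])
    (fun h => absurd (Finset.mem_univ i) h), smul_smul, mul_comm]

/-- Testing `x` against all `tᵏ cᵢ` reads off every polar coefficient of `xᵢ B(bᵢ, cᵢ)`, so this
product is regular and `xᵢ` vanishes to the order of the pole. Together with the converse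
`residueForm_eq_zero_of_truncation`, this makes the rank of the residue form the sum of the diagonal
pole orders. -/
theorem ker_residueForm_le {b : Basis ι (PowerSeries K) M} {c : Basis ι (PowerSeries K) N}
    {B : M →ₗ[PowerSeries K] N →ₗ[PowerSeries K] LaurentSeries K}
    (h : ∀ i j, i ≠ j → B (b i) (c j) = 0) :
    LinearMap.ker (residueForm B) ≤
      LinearMap.ker (truncation b fun i => poleOrder (B (b i) (c i))) := by
  intro x hx
  rw [LinearMap.mem_ker, truncation_eq_zero_iff]
  intro i
  apply X_pow_dvd_of_smul_regular
  intro n hn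
  have h1 : B x (c i) = b.repr x i • B (b i) (c i) := by
    classical
    rw [apply_eq_sum_of_diagonal h, Finset.sum_eq_single i]
    · simp
    · intro j _ hj
      simp [Finsupp.single_eq_of_ne hj]
    · simp
  -- Multiplication by `t ^ (-1 - n)` moves the coefficient at `n < 0` to the residue position `-1`.
  have h2 := LinearMap.congr_fun hx ((PowerSeries.X ^ (-1 - n).toNat : PowerSeries K) • c i)
  rw [residueForm_apply, map_smul, coeff_X_pow_smul, h1] at h2
  have h3 : -1 - ((-1 - n).toNat : ℤ) = n := by omega
  rw [h3] at h2
  exact h2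

theorem coeff_neg_one_smul_of_dvd {f : LaurentSeries K} {r : PowerSeries K}
    (h : PowerSeries.X ^ poleOrder f ∣ r) : (r • f).coeff (-1) = 0 := by
  obtain ⟨s, rfl⟩ := h
  obtain ⟨t, ht⟩ := mem_polesLE.1 (mem_polesLE_poleOrder f)
  rw [mul_comm, mul_smul, ← ht, ← Algebra.linearMap_apply, ← map_smul, Algebra.linearMap_apply]
  exact exists_powerSeries_iff.1 ⟨_, rfl⟩ _ (by norm_num)

theorem residueForm_eq_zero_of_truncation {b : Basis ι (PowerSeries K) M}
    {c : Basis ι (PowerSeries K) N}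
    {B : M →ₗ[PowerSeries K] N →ₗ[PowerSeries K] LaurentSeries K}
    (h : ∀ i j, i ≠ j → B (b i) (c j) = 0) (x : M)
    (hx : truncation b (fun i => poleOrder (B (b i) (c i))) x = 0) : residueForm B x = 0 := by
  rw [truncation_eq_zero_iff] at hx
  ext y
  rw [residueForm_apply, apply_eq_sum_of_diagonal h, HahnSeries.coeff_sum]
  exact Finset.sum_eq_zero fun i _ => coeff_neg_one_smul_of_dvd (Dvd.dvd.mul_right (hx i) _)

theorem sum_poleOrder_le_finrank {b : Basis ι (PowerSeries K) M} {c : Basis ι (PowerSeries K) N}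
    {B : M →ₗ[PowerSeries K] N →ₗ[PowerSeries K] LaurentSeries K}
    (h : ∀ i j, i ≠ j → B (b i) (c j) = 0) [FiniteDimensional K (LinearMap.range (residueForm B))] :
    ∑ i, poleOrder (B (b i) (c i)) ≤ finrank K (LinearMap.range (residueForm B)) := by
  have := (finrank_range_le_of_ker_le (f := residueForm B)
    (g := truncation b fun i => poleOrder (B (b i) (c i))) (ker_residueForm_le h)).2
  rwa [LinearMap.range_eq_top.2 (truncation_surjective b _), finrank_top,
    finrank_truncation_target] at this

theorem finiteDimensional_range_residueForm {b : Basis ι (PowerSeries K) M}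
    {B : M →ₗ[PowerSeries K] M →ₗ[PowerSeries K] LaurentSeries K}
    (h : ∀ i j, i ≠ j → B (b i) (b j) = 0) :
    FiniteDimensional K (LinearMap.range (residueForm B)) :=
  (finrank_range_le_of_ker_le fun x hx => residueForm_eq_zero_of_truncation h x hx).1

end Form

/-! ### Signature of the residue form over an ordered field -/

section Ordered

variable [LinearOrder K] [IsStrictOrderedRing K]

/-- The number of positive squares of the residue form of `f`. -/
def posIndex (f : LaurentSeries K) : ℕ :=
  if 0 < f.leadingCoeff then (poleOrder f + 1) / 2 else poleOrder f / 2

/-- The number of negative squares of the residue form of `f`. -/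
def negIndex (f : LaurentSeries K) : ℕ :=
  if f.leadingCoeff < 0 then (poleOrder f + 1) / 2 else poleOrder f / 2

theorem negIndex_eq (f : LaurentSeries K) : negIndex f = posIndex (-f) := by
  simp [negIndex, posIndex, poleOrder, HahnSeries.leadingCoeff_neg]

omit [IsStrictOrderedRing K] in
theorem posIndex_add_negIndex (f : LaurentSeries K) : posIndex f + negIndex f = poleOrder f := by
  unfold posIndex negIndex
  rcases lt_trichotomy f.leadingCoeff 0 with h | h | h
  · rw [if_neg h.not_gt, if_pos h]; omega
  · rw [HahnSeries.leadingCoeff_eq_zero] at h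
    simp [h]
  · rw [if_pos h, if_neg h.not_gt]; omega

/-- A factor `t ^ posIndex f` in `r` appears squared in `r² f`. It removes the whole pole unless the
pole order is `2 * posIndex f + 1`. In that case the leading coefficient is not positive, and the
residue is a square times it. -/
theorem residue_mul_self_nonpos {f : LaurentSeries K} {r : PowerSeries K}
    (h : PowerSeries.X ^ posIndex f ∣ r) : ((r * r) • f).coeff (-1) ≤ 0 := by
  by_cases h2 : poleOrder f ≤ 2 * posIndex f
  · refine (coeff_neg_one_smul_of_dvd ?_).le
    refine (pow_dvd_pow _ h2).trans ?_
    rw [two_mul, _root_.pow_add]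
    exact mul_dvd_mul h h
  · obtain ⟨s, rfl⟩ := h
    have h3 : ¬ 0 < f.leadingCoeff := by
      intro h4
      rw [posIndex, if_pos h4] at h2
      omega
    have h4 : f.order = -(2 * posIndex f : ℕ) - 1 := by
      rw [posIndex, if_neg h3] at h2 ⊢
      unfold poleOrder at h2 ⊢
      omega
    -- With `r = t ^ posIndex f * s`, the residue of `r² f` is the coefficient of `s² f` at the
    -- order of `f`, where only the constant term of `s²` contributes.
    rw [show PowerSeries.X ^ posIndex f * s * (PowerSeries.X ^ posIndex f * s) =
      PowerSeries.X ^ (2 * posIndex f) * (s * s) by ring, mul_smul, coeff_X_pow_smul,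
      show (-1 : ℤ) - (2 * posIndex f : ℕ) = f.order by rw [h4]; ring]
    have h5 : ((s * s) • f).coeff f.order = (PowerSeries.constantCoeff s) ^ 2 * f.leadingCoeff := by
      have h6 : ∃ g : PowerSeries K, s * s =
          PowerSeries.C ((PowerSeries.constantCoeff s) ^ 2) + PowerSeries.X * g := by
        have : PowerSeries.X ∣ s * s - PowerSeries.C ((PowerSeries.constantCoeff s) ^ 2) := by
          rw [PowerSeries.X_dvd_iff]
          simp [sq]
        obtain ⟨g, hg⟩ := this
        exact ⟨g, by rw [← hg]; ring⟩
      obtain ⟨g, hg⟩ := h6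
      rw [hg, add_smul, HahnSeries.coeff_add, C_smul_laurentSeries, HahnSeries.coeff_smul,
        smul_eq_mul, ← HahnSeries.leadingCoeff_eq]
      convert add_zero _
      rw [← pow_one PowerSeries.X, mul_smul, coeff_X_pow_smul]
      have h7 : poleOrder (g • f) ≤ poleOrder f :=
        mem_polesLE_iff.1 (Submodule.smul_mem _ _ (mem_polesLE_poleOrder f))
      refine poleOrder_le_iff_coeff.1 h7 _ ?_
      unfold poleOrder
      omega
    rw [h5]
    exact mul_nonpos_of_nonneg_of_nonpos (sq_nonneg _) (not_lt.1 h3)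

section RealForm

variable {M : Type*} [AddCommGroup M] [Module (PowerSeries K) M] [Module K M]
    [IsScalarTower K (PowerSeries K) M] {ι : Type*} [Fintype ι]

theorem residueForm_nonpos {b : Basis ι (PowerSeries K) M}
    {B : M →ₗ[PowerSeries K] M →ₗ[PowerSeries K] LaurentSeries K}
    (h : ∀ i j, i ≠ j → B (b i) (b j) = 0) (x : M)
    (hx : truncation b (fun i => posIndex (B (b i) (b i))) x = 0) : residueForm B x x ≤ 0 := by
  rw [truncation_eq_zero_iff] at hx
  rw [residueForm_apply, apply_eq_sum_of_diagonal h, HahnSeries.coeff_sum]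
  exact Finset.sum_nonpos fun i _ => residue_mul_self_nonpos (hx i)

theorem residueForm_nonneg {b : Basis ι (PowerSeries K) M}
    {B : M →ₗ[PowerSeries K] M →ₗ[PowerSeries K] LaurentSeries K}
    (h : ∀ i j, i ≠ j → B (b i) (b j) = 0) (x : M)
    (hx : truncation b (fun i => negIndex (B (b i) (b i))) x = 0) : 0 ≤ residueForm B x x := by
  have := residueForm_nonpos (B := -B) (b := b) (fun i j hij => by simp [h i j hij]) x
    ((truncation_eq_zero_iff _ _ _).2 fun i => by
      have := (truncation_eq_zero_iff _ _ _).1 hx i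
      rwa [negIndex_eq] at this)
  simpa using this

end RealForm

end Ordered

end Laurent

/-! ### Minors of a matrix and the rank of its residue form -/

section Pairing

open Module

variable {K : Type*} [Field K] {ι κ : Type*} [Fintype ι] [Fintype κ]

/-- The pairing `x, y ↦ xᵀ G y` of `K[[t]]`-modules defined by a matrix over `K((t))`. -/
def pairing (G : Matrix ι κ (LaurentSeries K)) :
    (ι → PowerSeries K) →ₗ[PowerSeries K] (κ → PowerSeries K) →ₗ[PowerSeries K] LaurentSeries K :=
  LinearMap.mk₂ (PowerSeries K) (fun x y => ∑ i, x i • ∑ j, y j • G i j)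
    (fun x x' y => by simp only [Pi.add_apply, add_smul, Finset.sum_add_distrib])
    (fun a x y => by simp only [Pi.smul_apply, smul_assoc, Finset.smul_sum])
    (fun x y y' => by simp only [Pi.add_apply, add_smul, Finset.sum_add_distrib, smul_add])
    (fun a x y => by
      simp only [Pi.smul_apply, smul_assoc, Finset.smul_sum]
      simp only [smul_comm a])

theorem pairing_apply (G : Matrix ι κ (LaurentSeries K)) (x : ι → PowerSeries K)
    (y : κ → PowerSeries K) : pairing G x y = ∑ i, x i • ∑ j, y j • G i j := rfl

theorem pairing_eq_dotProduct (G : Matrix ι κ (LaurentSeries K)) (x : ι → PowerSeries K)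
    (y : κ → PowerSeries K) : pairing G x y =
      (algebraMap _ (LaurentSeries K) ∘ x) ⬝ᵥ (G *ᵥ (algebraMap _ (LaurentSeries K) ∘ y)) := by
  simp only [pairing_apply, dotProduct, mulVec, Algebra.smul_def, Function.comp]
  simp only [mul_comm]

@[simp]
theorem pairing_single [DecidableEq ι] [DecidableEq κ] (G : Matrix ι κ (LaurentSeries K)) (i : ι)
    (j : κ) : pairing G (Pi.single i 1) (Pi.single j 1) = G i j := by
  rw [pairing_apply, Finset.sum_eq_single i, Finset.sum_eq_single j]
  · simp
  · intro l _ hl; simp [hl]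
  · simp
  · intro l _ hl; simp [hl]
  · simp

theorem pairing_comm {H : Matrix ι ι (LaurentSeries K)} (hH : H.IsSymm) (x y : ι → PowerSeries K) :
    pairing H x y = pairing H y x := by
  simp only [pairing_apply, Finset.smul_sum]
  rw [Finset.sum_comm]
  refine Finset.sum_congr rfl fun i _ => Finset.sum_congr rfl fun j _ => ?_
  rw [smul_comm, hH.apply i j]

theorem pairing_mul_left (G : Matrix ι κ (LaurentSeries K)) {α : Type*} [Fintype α]
    (S : Matrix ι α (PowerSeries K)) (x : α → PowerSeries K) (y : κ → PowerSeries K) :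
    pairing ((S.map (algebraMap _ (LaurentSeries K)))ᵀ * G) x y = pairing G (S *ᵥ x) y := by
  rw [pairing_eq_dotProduct, pairing_eq_dotProduct, ← mulVec_mulVec, dotProduct_mulVec,
    vecMul_transpose]
  congr 1
  ext i
  simp [mulVec, dotProduct]

theorem pairing_mul_right (G : Matrix ι κ (LaurentSeries K)) {β : Type*} [Fintype β]
    (T : Matrix κ β (PowerSeries K)) (x : ι → PowerSeries K) (y : β → PowerSeries K) :
    pairing (G * T.map (algebraMap _ (LaurentSeries K))) x y = pairing G x (T *ᵥ y) := by
  rw [pairing_eq_dotProduct, pairing_eq_dotProduct, ← mulVec_mulVec]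
  congr 2
  ext i
  simp [mulVec, dotProduct]

/-- Multilinearity of the determinant in its rows. With `P` the series with poles of order at most
`N`, a bound on the poles of minors passes to all regular combinations of rows. -/
theorem det_sum_smul_mem (P : Submodule (PowerSeries K) (LaurentSeries K)) {k : ℕ}
    (x : Fin k → ι → PowerSeries K) (M : ι → Fin k → LaurentSeries K)
    (h : ∀ f : Fin k → ι, (Matrix.of fun a => M (f a)).det ∈ P) :
    (Matrix.of fun a => ∑ l, x a l • M l).det ∈ P := by
  have h1 : (Matrix.of fun a => ∑ l, x a l • M l).det =
      ∑ f : Fin k → ι, (∏ a, x a (f a)) • (Matrix.of fun a => M (f a)).det := by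
    have := (Matrix.detRowAlternating (R := LaurentSeries K) (n := Fin k)).toMultilinearMap.map_sum
      fun a l => algebraMap (PowerSeries K) (LaurentSeries K) (x a l) • M l
    simp only [MultilinearMap.map_smul_univ] at this
    simp only [← map_prod, algebraMap_smul] at this
    exact this
  rw [h1]
  exact Submodule.sum_mem _ fun f _ => P.smul_mem _ (h f)

/-- Minors in new bases are combinations of minors in the old bases. -/
theorem det_pairing_mem (P : Submodule (PowerSeries K) (LaurentSeries K)) {k : ℕ}
    (G : Matrix ι κ (LaurentSeries K)) (x : Fin k → ι → PowerSeries K)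
    (y : Fin k → κ → PowerSeries K)
    (h : ∀ (f : Fin k → ι) (g : Fin k → κ), (G.submatrix f g).det ∈ P) :
    (Matrix.of fun a a' => pairing G (x a) (y a')).det ∈ P := by
  have h1 : (Matrix.of fun a a' => pairing G (x a) (y a')) =
      Matrix.of fun a => ∑ l, x a l • fun a' => ∑ j, y a' j • G l j := by
    ext a a'
    simp [pairing_apply]
  rw [h1]
  refine det_sum_smul_mem P x _ fun f => ?_
  rw [← det_transpose]
  have h2 : (Matrix.of fun a a' => ∑ j, y a' j • G (f a) j)ᵀ =
      Matrix.of fun a' => ∑ j, y a' j • fun a => G (f a) j := by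
    ext a a'
    simp
  rw [h2]
  refine det_sum_smul_mem P y _ fun g => ?_
  rw [← det_transpose]
  exact h f g

/-- In the standard bases `G` is the diagonal matrix transformed by regular matrices, so its
determinant is a regular combination of determinants of rearranged diagonal matrices. Each of these
is zero or, up to sign, the product of the diagonal entries. -/
theorem poleOrder_det_le_sum {k : ℕ} (G : Matrix (Fin k) (Fin k) (LaurentSeries K))
    {b c : Basis (Fin k) (PowerSeries K) (Fin k → PowerSeries K)}
    (h : ∀ i j, i ≠ j → pairing G (b i) (c j) = 0) :
    poleOrder G.det ≤ ∑ i, poleOrder (pairing G (b i) (c i)) := by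
  obtain ⟨D, hD⟩ : ∃ D : Fin k → LaurentSeries K, D = fun i => pairing G (b i) (c i) := ⟨_, rfl⟩
  have hD' : ∀ i, pairing G (b i) (c i) = D i := fun i => by rw [hD]
  have h1 : G = Matrix.of fun a a' =>
      pairing (diagonal D) (b.repr (Pi.single a 1)) (c.repr (Pi.single a' 1)) := by
    refine Matrix.ext fun a a' => ?_
    rw [← pairing_single G a a', apply_eq_sum_of_diagonal h, Matrix.of_apply, pairing_apply]
    refine Finset.sum_congr rfl fun i _ => ?_
    rw [Finset.sum_eq_single i, diagonal_apply_eq, smul_smul, hD']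
    · intro j _ hj
      rw [diagonal_apply_ne _ hj.symm, smul_zero]
    · simp
  simp only [hD']
  rw [← mem_polesLE_iff]
  suffices h0 : (Matrix.of fun a a' => pairing (diagonal D) (b.repr (Pi.single a 1))
      (c.repr (Pi.single a' 1))).det ∈ polesLE K (∑ i, poleOrder (D i)) by
    rwa [← h1] at h0
  refine det_pairing_mem _ _ _ _ fun f g => ?_
  by_cases hf : Function.Injective f
  · by_cases hg : Function.Injective g
    · have hf' := (Finite.injective_iff_bijective).1 hf
      have hg' := (Finite.injective_iff_bijective).1 hg
      have h2 : ((diagonal D).submatrix f g) =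
          ((diagonal D).submatrix (Equiv.ofBijective f hf')
            (Equiv.ofBijective g hg')) := rfl
      have h3 : ∏ i, D i ∈
          polesLE K (∑ i, poleOrder (D i)) :=
        prod_mem_polesLE _ _ _ fun i _ => mem_polesLE_poleOrder _
      have h4 : ((diagonal D).submatrix (Equiv.ofBijective f hf')
          (Equiv.ofBijective g hg')) = ((diagonal D).submatrix
            (Equiv.refl _) ((Equiv.ofBijective f hf').symm.trans
              (Equiv.ofBijective g hg'))).submatrix
            (Equiv.ofBijective f hf') (Equiv.ofBijective f hf') := by
        ext; simp
      rw [h2, h4, det_submatrix_equiv_self]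
      have h5 := det_permute' ((Equiv.ofBijective f hf').symm.trans (Equiv.ofBijective g hg'))
        (diagonal D)
      rw [show (⇑(Equiv.refl (Fin k)) : Fin k → Fin k) = id from rfl, h5, det_diagonal,
        ← zsmul_eq_mul]
      exact Submodule.smul_of_tower_mem _ _ h3
    · rw [← det_transpose, transpose_submatrix]
      simp only [Function.Injective, not_forall] at hg
      obtain ⟨i, j, hij, hne⟩ := hg
      rw [det_zero_of_row_eq hne (by ext l; simp [hij])]
      exact Submodule.zero_mem _
  · simp only [Function.Injective, not_forall] at hf
    obtain ⟨i, j, hij, hne⟩ := hf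
    rw [det_zero_of_row_eq hne (by ext l; simp [hij])]
    exact Submodule.zero_mem _

/-- The determinant cannot have more poles than the diagonal entries of a diagonalization have
together, and that total is at most the rank of the residue form. -/
theorem poleOrder_det_le_finrank {k : ℕ} (G : Matrix (Fin k) (Fin k) (LaurentSeries K))
    [FiniteDimensional K (LinearMap.range (residueForm (pairing G)))] :
    poleOrder G.det ≤ finrank K (LinearMap.range (residueForm (pairing G))) := by
  obtain ⟨b, c, h⟩ := exists_diagonalizing_bases k (finrank_fin_fun (PowerSeries K))
    (finrank_fin_fun (PowerSeries K)) (pairing G)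
  exact (poleOrder_det_le_sum G h).trans (sum_poleOrder_le_finrank h)

theorem poleOrder_prod {α : Type*} (s : Finset α) (f : α → LaurentSeries K)
    (h : ∀ i ∈ s, f i ≠ 0) : (∏ i ∈ s, f i).order = ∑ i ∈ s, (f i).order := by
  classical
  induction s using Finset.induction_on with
  | empty => simp
  | insert a s ha ih =>
    rw [Finset.prod_insert ha, Finset.sum_insert ha,
      HahnSeries.order_mul (h a (Finset.mem_insert_self a s))
        (Finset.prod_ne_zero_iff.2 fun i hi => h i (Finset.mem_insert_of_mem hi)),
      ih fun i hi => h i (Finset.mem_insert_of_mem hi)]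

/-- The pole orders of a diagonalization are realized by a minor. -/
theorem exists_sum_poleOrder_le {m : ℕ} (H : Matrix (Fin m) (Fin m) (LaurentSeries K))
    {b : Basis (Fin m) (PowerSeries K) (Fin m → PowerSeries K)}
    (h : ∀ i j, i ≠ j → pairing H (b i) (b j) = 0) :
    ∃ k ≤ m, ∃ f g : Fin k → Fin m,
      ∑ i, poleOrder (pairing H (b i) (b i)) ≤ poleOrder (H.submatrix f g).det := by
  classical
  set D : Fin m → LaurentSeries K := fun i => pairing H (b i) (b i) with hD
  -- Only the entries with a pole are kept: zeros of the others would cancel poles in the product.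
  set T := Finset.univ.filter fun i => poleOrder (D i) ≠ 0 with hT
  set k := T.card with hk
  refine ⟨k, by simpa using Finset.card_le_univ T, ?_⟩
  let e : Fin k ≃ T := T.equivFin.symm
  have : Nonempty ((Fin k → Fin m) × (Fin k → Fin m)) :=
    ⟨(fun a => (e a : Fin m), fun a => (e a : Fin m))⟩
  -- The minor of the diagonalized form on `T` is a regular combination of minors of `H` of the same
  -- size, so the worst of these has at least its pole order.
  obtain ⟨⟨f, g⟩, hfg⟩ := Finite.exists_max
    fun p : (Fin k → Fin m) × (Fin k → Fin m) => poleOrder (H.submatrix p.1 p.2).det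
  refine ⟨f, g, ?_⟩
  have h1 := det_pairing_mem (polesLE K (poleOrder (H.submatrix f g).det)) H (fun a => b (e a))
    (fun a => b (e a)) fun f' g' => mem_polesLE_iff.2 (hfg (f', g'))
  have h2 : (Matrix.of fun a a' => pairing H (b (e a)) (b (e a'))) =
      diagonal fun a => D (e a) := by
    refine Matrix.ext fun a a' => ?_
    rw [Matrix.of_apply]
    by_cases haa : a = a'
    · rw [haa, diagonal_apply_eq]
    · rw [diagonal_apply_ne _ haa]
      exact h _ _ fun h3 => haa (e.injective (Subtype.ext h3))
  rw [h2, det_diagonal, e.prod_comp (fun i : T => D i), Finset.prod_coe_sort T D,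
    mem_polesLE_iff] at h1
  refine le_trans (le_of_eq ?_) h1
  have h3 : ∀ i ∈ T, D i ≠ 0 := fun i hi h4 => by
    rw [hT, Finset.mem_filter, h4, poleOrder_zero] at hi
    exact hi.2 rfl
  have h4 : ∑ i, poleOrder (D i) = ∑ i ∈ T, poleOrder (D i) := by
    rw [hT, Finset.sum_filter_ne_zero]
  have h5 : ((∑ i ∈ T, poleOrder (D i) : ℕ) : ℤ) = -∑ i ∈ T, (D i).order := by
    rw [Nat.cast_sum, ← Finset.sum_neg_distrib]
    refine Finset.sum_congr rfl fun i hi => ?_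
    rw [hT, Finset.mem_filter] at hi
    have := hi.2
    unfold poleOrder at this ⊢
    omega
  rw [h4]
  unfold poleOrder at h5 ⊢
  rw [poleOrder_prod T D h3]
  omega

/-- A minor of `Sᵀ H` is the determinant of a pairing that factors through the residue form of
`H`, so its pole order is bounded by a rank. -/
theorem poleOrder_minor_le_finrank {m n k : ℕ} (H : Matrix (Fin m) (Fin m) (LaurentSeries K))
    (S : Matrix (Fin m) (Fin n) (PowerSeries K))
    [FiniteDimensional K (LinearMap.range (residueForm (pairing H)))] (r : Fin k → Fin n)
    (c : Fin k → Fin m) :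
    poleOrder (((S.map (algebraMap _ (LaurentSeries K)))ᵀ * H).submatrix r c).det ≤
      finrank K (LinearMap.range
        (residueForm (pairing H) ∘ₗ (S.mulVecLin.restrictScalars K))) := by
  set G := (S.map (algebraMap _ (LaurentSeries K)))ᵀ * H with hG
  -- The selections of rows and columns as linear maps between lattices. They factor the residue
  -- form of the submatrix through `β ∘ S`, and rank can only drop.
  let Er := (Fintype.linearCombination (PowerSeries K)
    fun a : Fin k => (Pi.single (r a) 1 : Fin n → PowerSeries K)).restrictScalars K
  let Ec := Fintype.linearCombination (PowerSeries K)
    fun a : Fin k => (Pi.single (c a) 1 : Fin m → PowerSeries K)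
  have h1 : ∀ x y, pairing (G.submatrix r c) x y = pairing H (S *ᵥ (Er x)) (Ec y) := by
    intro x y
    rw [← pairing_mul_left, ← hG]
    simp only [Er, Ec, LinearMap.restrictScalars_apply, Fintype.linearCombination_apply, map_sum,
      LinearMap.sum_apply, map_smul, LinearMap.smul_apply, pairing_single]
    simp only [pairing_apply, submatrix_apply, Finset.smul_sum]
    rw [Finset.sum_comm]
    refine Finset.sum_congr rfl fun i _ => Finset.sum_congr rfl fun j _ => ?_
    rw [smul_comm]
  set A := residueForm (pairing H) ∘ₗ (S.mulVecLin.restrictScalars K) with hA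
  have hAf := (finrank_range_comp_le (residueForm (pairing H))
    (S.mulVecLin.restrictScalars K)).1
  rw [← hA] at hAf
  obtain ⟨h2, h3⟩ := finrank_range_comp_le A Er
  obtain ⟨h4, h5⟩ := finrank_range_le_of_ker_le (f := A ∘ₗ Er)
    (g := residueForm (pairing (G.submatrix r c))) (by
      intro x hx
      rw [LinearMap.mem_ker] at hx ⊢
      refine LinearMap.ext fun y => ?_
      have := LinearMap.congr_fun hx (Ec y)
      rw [residueForm_apply, h1]
      exact this)
  exact (poleOrder_det_le_finrank _).trans (h5.trans h3)

end Pairing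

/-! ### Local inequalities at one place -/

section Local

open Module

variable {K : Type*} [Field K]

/-- A basis of `K[[t]]ᵐ` in which the form `xᵀ H y` is diagonal. -/
def IsOrthogonalBasis {m : ℕ} (H : Matrix (Fin m) (Fin m) (LaurentSeries K))
    (b : Basis (Fin m) (PowerSeries K) (Fin m → PowerSeries K)) : Prop :=
  ∀ i j, i ≠ j → pairing H (b i) (b j) = 0

theorem exists_isOrthogonalBasis (h2 : (2 : K) ≠ 0) {m : ℕ}
    {H : Matrix (Fin m) (Fin m) (LaurentSeries K)} (hH : H.IsSymm) :
    ∃ b, IsOrthogonalBasis H b := by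
  have h2' : IsUnit (2 : PowerSeries K) := by
    rw [PowerSeries.isUnit_iff_constantCoeff, map_ofNat]
    exact h2.isUnit
  exact exists_orthogonal_basis h2' m (finrank_fin_fun (PowerSeries K)) (pairing H)
    (pairing_comm hH)

variable {m n : ℕ} {H : Matrix (Fin m) (Fin m) (LaurentSeries K)}
  {S : Matrix (Fin m) (Fin n) (PowerSeries K)}
  {b : Basis (Fin m) (PowerSeries K) (Fin m → PowerSeries K)}
  {c : Basis (Fin n) (PowerSeries K) (Fin n → PowerSeries K)}

/-- `S` is regular, hence maps lattice to lattice, so the residue form of the congruence is a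
pull-back and the abstract rank inequalities apply. -/
theorem residueForm_congruence (x y : Fin n → PowerSeries K) :
    residueForm (pairing ((S.map (algebraMap _ (LaurentSeries K)))ᵀ * H *
      S.map (algebraMap _ (LaurentSeries K)))) x y =
    residueForm (pairing H) (S.mulVecLin.restrictScalars K x)
      (S.mulVecLin.restrictScalars K y) := by
  rw [residueForm_apply, residueForm_apply, pairing_mul_right, pairing_mul_left]
  rfl

theorem residueForm_pairing_comm (hH : H.IsSymm) (x y : Fin m → PowerSeries K) :
    residueForm (pairing H) x y = residueForm (pairing H) y x := by
  rw [residueForm_apply, residueForm_apply, pairing_comm hH]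

/-- The inequality without signs, with the truncations in the orthogonal bases as `f` and `g`: they
vanish only on vectors in the radicals of the residue forms, and their targets have the sums of the
pole orders as dimensions. -/
theorem two_mul_poleOrder_minor_le (hH : H.IsSymm) (hb : IsOrthogonalBasis H b)
    (hc : IsOrthogonalBasis ((S.map (algebraMap _ (LaurentSeries K)))ᵀ * H *
      S.map (algebraMap _ (LaurentSeries K))) c) {k : ℕ} (r : Fin k → Fin n) (s : Fin k → Fin m) :
    2 * poleOrder (((S.map (algebraMap _ (LaurentSeries K)))ᵀ * H).submatrix r s).det ≤
      ∑ i, poleOrder (pairing H (b i) (b i)) +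
      ∑ i, poleOrder (pairing ((S.map (algebraMap _ (LaurentSeries K)))ᵀ * H *
        S.map (algebraMap _ (LaurentSeries K))) (c i) (c i)) := by
  have := finiteDimensional_range_residueForm hb
  have h1 := poleOrder_minor_le_finrank H S r s
  have h2 := two_mul_finrank_range_comp_le (residueForm_pairing_comm hH)
    (S.mulVecLin.restrictScalars K) (truncation b fun i => poleOrder (pairing H (b i) (b i)))
    (truncation c fun i => poleOrder (pairing ((S.map (algebraMap _ (LaurentSeries K)))ᵀ * H *
        S.map (algebraMap _ (LaurentSeries K))) (c i) (c i)))
    (fun x hx => residueForm_eq_zero_of_truncation hb x hx)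
    (fun u hu u' => by
      rw [← residueForm_congruence, residueForm_eq_zero_of_truncation hc u hu]
      rfl)
  rw [finrank_truncation_target, finrank_truncation_target] at h2
  omega

variable [LinearOrder K] [IsStrictOrderedRing K]

/-- Truncating each coordinate to `posIndex` terms for `H` and `negIndex` terms for `SᵀHS` cuts out
subspaces on which the two residue forms have opposite semidefinite signs. -/
theorem poleOrder_minor_le_posIndex_add_negIndex (hH : H.IsSymm) (hb : IsOrthogonalBasis H b)
    (hc : IsOrthogonalBasis ((S.map (algebraMap _ (LaurentSeries K)))ᵀ * H *
      S.map (algebraMap _ (LaurentSeries K))) c) {k : ℕ} (r : Fin k → Fin n) (s : Fin k → Fin m) :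
    poleOrder (((S.map (algebraMap _ (LaurentSeries K)))ᵀ * H).submatrix r s).det ≤
      ∑ i, posIndex (pairing H (b i) (b i)) +
      ∑ i, negIndex (pairing ((S.map (algebraMap _ (LaurentSeries K)))ᵀ * H *
        S.map (algebraMap _ (LaurentSeries K))) (c i) (c i)) := by
  have := finiteDimensional_range_residueForm hb
  have h1 := poleOrder_minor_le_finrank H S r s
  have h2 := finrank_range_comp_le_of_semidefinite (residueForm_pairing_comm hH)
    (S.mulVecLin.restrictScalars K) (truncation b fun i => posIndex (pairing H (b i) (b i)))
    (truncation c fun i => negIndex (pairing ((S.map (algebraMap _ (LaurentSeries K)))ᵀ * H *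
        S.map (algebraMap _ (LaurentSeries K))) (c i) (c i)))
    (fun x hx => residueForm_nonpos hb x hx)
    (fun u hu => by
      rw [← residueForm_congruence]
      exact residueForm_nonneg hc u hu)
  rw [finrank_truncation_target, finrank_truncation_target] at h2
  omega

omit [LinearOrder K] [IsStrictOrderedRing K] in
theorem pairing_neg {ι κ : Type*} [Fintype ι] [Fintype κ] (G : Matrix ι κ (LaurentSeries K))
    (x : ι → PowerSeries K) (y : κ → PowerSeries K) : pairing (-G) x y = -pairing G x y := by
  simp [pairing_apply, Finset.sum_neg_distrib]

/-- The previous bound for `-H`: the same bases stay orthogonal, the two indices are exchanged, and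
minors change at most by a sign. -/
theorem poleOrder_minor_le_negIndex_add_posIndex (hH : H.IsSymm) (hb : IsOrthogonalBasis H b)
    (hc : IsOrthogonalBasis ((S.map (algebraMap _ (LaurentSeries K)))ᵀ * H *
      S.map (algebraMap _ (LaurentSeries K))) c) {k : ℕ} (r : Fin k → Fin n) (s : Fin k → Fin m) :
    poleOrder (((S.map (algebraMap _ (LaurentSeries K)))ᵀ * H).submatrix r s).det ≤
      ∑ i, negIndex (pairing H (b i) (b i)) +
      ∑ i, posIndex (pairing ((S.map (algebraMap _ (LaurentSeries K)))ᵀ * H *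
        S.map (algebraMap _ (LaurentSeries K))) (c i) (c i)) := by
  have hb' : IsOrthogonalBasis (-H) b := fun i j hij => by rw [pairing_neg, hb i j hij, neg_zero]
  have hc' : IsOrthogonalBasis ((S.map (algebraMap _ (LaurentSeries K)))ᵀ * (-H) *
      S.map (algebraMap _ (LaurentSeries K))) c := fun i j hij => by
    rw [Matrix.mul_neg, Matrix.neg_mul, pairing_neg, hc i j hij, neg_zero]
  have h := poleOrder_minor_le_posIndex_add_negIndex (H := -H) (hH.neg) hb' hc' r s
  simp only [Matrix.mul_neg, Matrix.neg_mul, pairing_neg, ← negIndex_eq] at h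
  have h1 : ∀ f : LaurentSeries K, negIndex (-f) = posIndex f := fun f => by
    rw [negIndex_eq, neg_neg]
  have h2 : ∀ f : LaurentSeries K, poleOrder (-f) = poleOrder f := fun f => by
    rw [poleOrder, HahnSeries.order_neg]; rfl
  simp only [h1] at h
  rw [show ((-((S.map (algebraMap _ (LaurentSeries K)))ᵀ * H)).submatrix r s) =
    -(((S.map (algebraMap _ (LaurentSeries K)))ᵀ * H).submatrix r s) from rfl, det_neg] at h
  rcases neg_one_pow_eq_or (LaurentSeries K) (Fintype.card (Fin k)) with h3 | h3
  · rwa [h3, one_mul] at h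
  · rwa [h3, neg_one_mul, h2] at h

end Local

/-! ### The min-max principle and bounds for quadratic forms -/

section MinMax

open Module

variable {m : ℕ} {A : Matrix (Fin m) (Fin m) ℝ}

theorem exists_ne_zero_coordinates_eq_zero (U : Matrix (Fin m) (Fin m) ℝ) {V : Type*}
    [AddCommGroup V] [Module ℝ V] [FiniteDimensional ℝ V] (g : V →ₗ[ℝ] Fin m → ℝ)
    (T : Finset (Fin m)) (hT : T.card < finrank ℝ V) :
    ∃ a ≠ 0, ∀ i ∈ T, (U *ᵥ g a) i = 0 := by
  let f : V →ₗ[ℝ] T → ℝ := (LinearMap.funLeft ℝ ℝ ((↑) : T → Fin m)) ∘ₗ U.mulVecLin ∘ₗ g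
  have hf : LinearMap.ker f ≠ ⊥ := by
    intro h
    have := LinearMap.finrank_le_finrank_of_injective (LinearMap.ker_eq_bot.1 h)
    simp at this
    omega
  obtain ⟨a, ha, ha0⟩ := Submodule.exists_mem_ne_zero_of_ne_bot hf
  exact ⟨a, ha0, fun i hi => congrFun (LinearMap.mem_ker.1 ha) ⟨i, hi⟩⟩

theorem spectral_coordinates (hA : A.IsHermitian) (y : Fin m → ℝ) :
    y ⬝ᵥ y = ∑ i, ((hA.eigenvectorUnitary : Matrix (Fin m) (Fin m) ℝ)ᵀ *ᵥ y) i ^ 2 ∧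
    y ⬝ᵥ A *ᵥ y = ∑ i, hA.eigenvalues i *
      ((hA.eigenvectorUnitary : Matrix (Fin m) (Fin m) ℝ)ᵀ *ᵥ y) i ^ 2 := by
  set U := (hA.eigenvectorUnitary : Matrix (Fin m) (Fin m) ℝ) with hU
  have hUU : U * Uᵀ = 1 := by
    have := (Matrix.mem_unitaryGroup_iff).1 hA.eigenvectorUnitary.2
    rwa [star_eq_conjTranspose, conjTranspose_eq_transpose_of_trivial] at this
  have key : ∀ D : Matrix (Fin m) (Fin m) ℝ,
      y ⬝ᵥ (U * D * Uᵀ) *ᵥ y = (Uᵀ *ᵥ y) ⬝ᵥ D *ᵥ (Uᵀ *ᵥ y) := fun D => by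
    rw [← mulVec_mulVec, ← mulVec_mulVec, dotProduct_mulVec, ← mulVec_transpose]
  constructor
  · have := key 1
    rw [Matrix.mul_one, hUU, one_mulVec, one_mulVec] at this
    rw [this, dotProduct]
    exact Finset.sum_congr rfl fun i _ => (sq _).symm
  · have hs : A = U * diagonal hA.eigenvalues * Uᵀ := by
      have := hA.spectral_theorem
      rw [Unitary.conjStarAlgAut_apply] at this
      rw [star_eq_conjTranspose, conjTranspose_eq_transpose_of_trivial] at this
      exact this
    conv_lhs => rw [hs]
    rw [key, dotProduct]
    refine Finset.sum_congr rfl fun i _ => ?_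
    rw [mulVec_diagonal]
    ring

theorem dotProduct_self_pos {y : Fin m → ℝ} (hy : y ≠ 0) : 0 < y ⬝ᵥ y :=
  lt_of_le_of_ne (Finset.sum_nonneg fun i _ => mul_self_nonneg (y i))
    fun h => hy (dotProduct_self_eq_zero.1 h.symm)

/-- The lower bound in the min-max principle. -/
theorem le_eigenvalues₀ (hA : A.IsHermitian) {V : Type*}
    [AddCommGroup V] [Module ℝ V] [FiniteDimensional ℝ V] (g : V →ₗ[ℝ] Fin m → ℝ)
    (hg : Function.Injective g) (j : Fin (Fintype.card (Fin m))) (hj : (j : ℕ) < finrank ℝ V)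
    {R : ℝ} (h : ∀ a, R * (g a ⬝ᵥ g a) ≤ g a ⬝ᵥ A *ᵥ g a) : R ≤ hA.eigenvalues₀ j := by
  set e : Fin m ≃ Fin (Fintype.card (Fin m)) := (Fintype.equivOfCardEq (Fintype.card_fin _)).symm
    with he
  -- As `j < dim V`, some nonzero vector of the image of `V` is orthogonal to the eigenvectors of
  -- the `j` eigenvalues that precede the `j`-th.
  obtain ⟨a, ha0, ha⟩ := exists_ne_zero_coordinates_eq_zero
    (hA.eigenvectorUnitary : Matrix (Fin m) (Fin m) ℝ)ᵀ g
    ((Finset.univ.filter (· < j)).map e.symm.toEmbedding) (by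
      rw [Finset.card_map]
      rw [show (Finset.univ.filter (· < j)) = Finset.Iio j by ext; simp, Fin.card_Iio]
      exact hj)
  obtain ⟨h1, h2⟩ := spectral_coordinates hA (g a)
  have h3 := h a
  have h4 := dotProduct_self_pos ((map_ne_zero_iff g hg).2 ha0)
  have h5 : g a ⬝ᵥ A *ᵥ g a ≤ hA.eigenvalues₀ j * (g a ⬝ᵥ g a) := by
    rw [h2, h1, Finset.mul_sum]
    refine Finset.sum_le_sum fun i _ => ?_
    by_cases hi : e i < j
    · rw [ha i (by simp [hi])]
      simp
    · exact mul_le_mul_of_nonneg_right (hA.eigenvalues₀_antitone (not_lt.1 hi)) (sq_nonneg _)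
  exact le_of_mul_le_mul_right (h3.trans h5) h4

/-- The upper bound in the min-max principle. -/
theorem eigenvalues₀_le (hA : A.IsHermitian) {V : Type*}
    [AddCommGroup V] [Module ℝ V] [FiniteDimensional ℝ V] (g : V →ₗ[ℝ] Fin m → ℝ)
    (hg : Function.Injective g) (j : Fin (Fintype.card (Fin m))) (hj : m ≤ j + finrank ℝ V)
    {R : ℝ} (h : ∀ a, g a ⬝ᵥ A *ᵥ g a ≤ R * (g a ⬝ᵥ g a)) : hA.eigenvalues₀ j ≤ R := by
  set e : Fin m ≃ Fin (Fintype.card (Fin m)) := (Fintype.equivOfCardEq (Fintype.card_fin _)).symm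
    with he
  obtain ⟨a, ha0, ha⟩ := exists_ne_zero_coordinates_eq_zero
    (hA.eigenvectorUnitary : Matrix (Fin m) (Fin m) ℝ)ᵀ g
    ((Finset.univ.filter (j < ·)).map e.symm.toEmbedding) (by
      rw [Finset.card_map]
      rw [show (Finset.univ.filter (j < ·)) = Finset.Ioi j by ext; simp, Fin.card_Ioi]
      have h1 := j.2
      have h2 := Fintype.card_fin m
      omega)
  obtain ⟨h1, h2⟩ := spectral_coordinates hA (g a)
  have h3 := h a
  have h4 := dotProduct_self_pos ((map_ne_zero_iff g hg).2 ha0)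
  have h5 : hA.eigenvalues₀ j * (g a ⬝ᵥ g a) ≤ g a ⬝ᵥ A *ᵥ g a := by
    rw [h2, h1, Finset.mul_sum]
    refine Finset.sum_le_sum fun i _ => ?_
    by_cases hi : j < e i
    · rw [ha i (by simp [hi])]
      simp
    · exact mul_le_mul_of_nonneg_right (hA.eigenvalues₀_antitone (not_lt.1 hi)) (sq_nonneg _)
  exact le_of_mul_le_mul_right (h5.trans h3) h4

theorem mulVec_dotProduct_self_le {N : Matrix (Fin m) (Fin m) ℝ} {C : ℝ} (hN : ∀ i j, |N i j| ≤ C)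
    (z : Fin m → ℝ) : (N *ᵥ z) ⬝ᵥ (N *ᵥ z) ≤ (m * (m * C ^ 2)) * (z ⬝ᵥ z) := by
  have h1 : ∀ i, (N *ᵥ z) i * (N *ᵥ z) i ≤ (m * C ^ 2) * (z ⬝ᵥ z) := fun i => by
    have h2 := Finset.sum_mul_sq_le_sq_mul_sq Finset.univ (N i) z
    have h3 : ∑ j, N i j ^ 2 ≤ m * C ^ 2 := by
      calc ∑ j, N i j ^ 2 ≤ ∑ _j : Fin m, C ^ 2 :=
            Finset.sum_le_sum fun j _ => sq_le_sq' (abs_le.1 (hN i j)).1 (abs_le.1 (hN i j)).2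
        _ = m * C ^ 2 := by simp
    have h4 : ∑ j, z j ^ 2 = z ⬝ᵥ z := Finset.sum_congr rfl fun j _ => sq _
    rw [h4] at h2
    rw [← sq]
    exact h2.trans (mul_le_mul_of_nonneg_right h3 (Finset.sum_nonneg fun j _ => mul_self_nonneg _))
  calc (N *ᵥ z) ⬝ᵥ (N *ᵥ z) ≤ ∑ _i : Fin m, (m * C ^ 2) * (z ⬝ᵥ z) :=
        Finset.sum_le_sum fun i _ => h1 i
    _ = _ := by simp; ring

/-- Off-diagonal entries of size at most `C` change a quadratic form by at most `m C`. -/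
theorem abs_dotProduct_mulVec_sub_diag_le {N : Matrix (Fin m) (Fin m) ℝ} {C : ℝ} (hC : 0 ≤ C)
    (hN : ∀ i j, i ≠ j → |N i j| ≤ C) (z : Fin m → ℝ) :
    |z ⬝ᵥ N *ᵥ z - ∑ i, N i i * z i ^ 2| ≤ m * C * (z ⬝ᵥ z) := by
  have h1 : z ⬝ᵥ N *ᵥ z - ∑ i, N i i * z i ^ 2 =
      ∑ i, ∑ j, (if i = j then 0 else N i j) * (z i * z j) := by
    rw [dotProduct, ← Finset.sum_sub_distrib]
    refine Finset.sum_congr rfl fun i _ => ?_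
    rw [mulVec, dotProduct, Finset.mul_sum, sub_eq_iff_eq_add]
    rw [← Finset.add_sum_erase _ _ (Finset.mem_univ i),
      ← Finset.add_sum_erase Finset.univ (fun j => (if i = j then 0 else N i j) * (z i * z j))
        (Finset.mem_univ i), if_pos rfl, zero_mul, zero_add, add_comm]
    congr 1
    · refine Finset.sum_congr rfl fun j hj => ?_
      rw [if_neg (Finset.ne_of_mem_erase hj).symm]
      ring
    · ring
  rw [h1]
  calc |∑ i, ∑ j, (if i = j then 0 else N i j) * (z i * z j)|
      ≤ ∑ i, ∑ j, |(if i = j then 0 else N i j) * (z i * z j)| :=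
        (Finset.abs_sum_le_sum_abs _ _).trans
          (Finset.sum_le_sum fun i _ => Finset.abs_sum_le_sum_abs _ _)
    _ ≤ ∑ i, ∑ j, C * ((z i ^ 2 + z j ^ 2) / 2) := by
        refine Finset.sum_le_sum fun i _ => Finset.sum_le_sum fun j _ => ?_
        rw [abs_mul]
        refine mul_le_mul ?_ ?_ (abs_nonneg _) hC
        · split_ifs with h
          · simpa using hC
          · exact hN i j h
        · rw [abs_le]
          constructor <;> nlinarith [sq_nonneg (z i + z j), sq_nonneg (z i - z j)]
    _ = m * C * (z ⬝ᵥ z) := by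
        simp only [← Finset.mul_sum, ← Finset.sum_div, Finset.sum_add_distrib, dotProduct, ← sq]
        simp only [Finset.sum_const, Finset.card_univ, Fintype.card_fin, nsmul_eq_mul,
          ← Finset.mul_sum]
        ring

/-- Extension of a vector by zero. -/
def extendZero (T : Finset (Fin m)) : (T → ℝ) →ₗ[ℝ] Fin m → ℝ where
  toFun a := fun i => if h : i ∈ T then a ⟨i, h⟩ else 0
  map_add' a b := by ext i; by_cases h : i ∈ T <;> simp [h]
  map_smul' r a := by ext i; by_cases h : i ∈ T <;> simp [h]

theorem extendZero_of_notMem {T : Finset (Fin m)} (a : T → ℝ) {i : Fin m} (h : i ∉ T) :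
    extendZero T a i = 0 := dif_neg h

theorem extendZero_injective (T : Finset (Fin m)) : Function.Injective (extendZero T) := by
  intro a b hab
  ext ⟨i, hi⟩
  have := congrFun hab i
  simpa [extendZero, hi] using this

end MinMax

/-! ### Counting eigenvalues that tend to `+∞` under a bounded congruence -/

section Count

variable {m : ℕ} {l : Filter ℝ} {A Q : ℝ → Matrix (Fin m) (Fin m) ℝ}

theorem exists_eventually_abs_le {N : ℝ → Matrix (Fin m) (Fin m) ℝ} {N₀ : Matrix (Fin m) (Fin m) ℝ}
    (h : Tendsto N l (𝓝 N₀)) : ∃ C, ∀ᶠ x in l, ∀ i j, |N x i j| ≤ C := by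
  have h1 : ∀ i j, ∀ᶠ x in l, |N x i j| ≤ |N₀ i j| + 1 := fun i j => by
    have h2 : Tendsto (fun x => |N x i j|) l (𝓝 |N₀ i j|) :=
      ((tendsto_pi_nhds.1 (tendsto_pi_nhds.1 h i) j)).abs
    exact (h2.eventually (gt_mem_nhds (lt_add_one _))).mono fun x hx => hx.le
  refine ⟨∑ i, ∑ j, (|N₀ i j| + 1), ?_⟩
  have h3 : ∀ᶠ x in l, ∀ i j, |N x i j| ≤ |N₀ i j| + 1 :=
    eventually_all.2 fun i => eventually_all.2 (h1 i)
  filter_upwards [h3] with x hx i j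
  refine (hx i j).trans ?_
  have h4 : ∀ i' j', 0 ≤ |N₀ i' j'| + 1 := fun i' j' => by positivity
  exact (Finset.single_le_sum (f := fun j' => |N₀ i j'| + 1) (fun j' _ => h4 i j')
    (Finset.mem_univ j)).trans (Finset.single_le_sum (f := fun i' => ∑ j', (|N₀ i' j'| + 1))
      (fun i' _ => Finset.sum_nonneg fun j' _ => h4 i' j') (Finset.mem_univ i))

/-- If a congruence with invertible limit makes `A` diagonal up to bounded off-diagonal entries,
the number of eigenvalues of `A` that tend to `+∞` is the number of diagonal entries that do. -/
theorem tendsto_eigenvalues₀_iff [l.NeBot] (hA : ∀ x, (A x).IsHermitian)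
    {Q₀ : Matrix (Fin m) (Fin m) ℝ} (hQ : Tendsto Q l (𝓝 Q₀)) (hQ₀ : IsUnit Q₀.det)
    (T : Finset (Fin m)) {C : ℝ}
    (hT : ∀ i ∈ T, Tendsto (fun x => ((Q x)ᵀ * A x * Q x) i i) l atTop)
    (hT' : ∀ i ∉ T, ∀ᶠ x in l, ((Q x)ᵀ * A x * Q x) i i ≤ C)
    (hoff : ∀ i j, i ≠ j → ∀ᶠ x in l, |((Q x)ᵀ * A x * Q x) i j| ≤ C)
    (i : Fin (Fintype.card (Fin m))) :
    Tendsto (fun x => (hA x).eigenvalues₀ i) l atTop ↔ (i : ℕ) < T.card := by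
  have hC0 : ∀ᶠ x in l, ∀ i j, i ≠ j → |((Q x)ᵀ * A x * Q x) i j| ≤ max C 0 := by
    refine eventually_all.2 fun i => eventually_all.2 fun j => ?_
    by_cases hij : i = j
    · exact Eventually.of_forall fun x h => absurd hij h
    · exact (hoff i j hij).mono fun x hx _ => hx.trans (le_max_left _ _)
  have hC1 : ∀ᶠ x in l, ∀ i ∉ T, ((Q x)ᵀ * A x * Q x) i i ≤ max C 0 := by
    refine eventually_all.2 fun i => ?_
    by_cases hi : i ∈ T
    · exact Eventually.of_forall fun x h => absurd hi h
    · exact (hT' i hi).mono fun x hx _ => hx.trans (le_max_left _ _)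
  have hdet : ∀ᶠ x in l, IsUnit (Q x).det := by
    have h1 : Tendsto (fun x => (Q x).det) l (𝓝 Q₀.det) :=
      ((continuous_id.matrix_det).tendsto Q₀).comp hQ
    filter_upwards [h1.eventually_ne hQ₀.ne_zero] with x hx using hx.isUnit
  have hform : ∀ x z, (Q x *ᵥ z) ⬝ᵥ A x *ᵥ (Q x *ᵥ z) =
      z ⬝ᵥ ((Q x)ᵀ * A x * Q x) *ᵥ z := fun x z => by
    rw [← mulVec_mulVec, ← mulVec_mulVec, dotProduct_mulVec z, vecMul_transpose]
  have hinj : ∀ x, IsUnit (Q x).det → ∀ T' : Finset (Fin m),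
      Function.Injective ((Q x).mulVecLin ∘ₗ extendZero T') := fun x hx T' => by
    rw [LinearMap.coe_comp]
    exact ((Matrix.mulVec_injective_iff_isUnit.2 ((Matrix.isUnit_iff_isUnit_det _).2 hx))).comp
      (extendZero_injective T')
  constructor
  · intro htop
    by_contra hi
    -- Boundedness of the inverse gives `z ⬝ᵥ z ≤ const * (Q z ⬝ᵥ Q z)`, which turns a bound for the
    -- form in the coordinates `z` into one for `A`.
    have hinv : Tendsto (fun x => (Q x)⁻¹) l (𝓝 Q₀⁻¹) := by
      have h1 : Tendsto (fun x => (Q x).det) l (𝓝 Q₀.det) :=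
        ((continuous_id.matrix_det).tendsto Q₀).comp hQ
      have h2 : Tendsto (fun x => (Q x).adjugate) l (𝓝 Q₀.adjugate) :=
        ((continuous_id.matrix_adjugate).tendsto Q₀).comp hQ
      simp only [Matrix.inv_def, Ring.inverse_eq_inv']
      exact (h1.inv₀ hQ₀.ne_zero).smul h2
    obtain ⟨D, hD⟩ := exists_eventually_abs_le hinv
    set C1 := max C 0 + m * max C 0 with hC1def
    have hC1n : 0 ≤ C1 := by positivity
    have hb : ∀ᶠ x in l, (hA x).eigenvalues₀ i ≤ C1 * (m * (m * D ^ 2)) := by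
      filter_upwards [hC0, hC1, hdet, hD] with x h0 h1 h2 h3
      refine eigenvalues₀_le (hA x) ((Q x).mulVecLin ∘ₗ extendZero Tᶜ) (hinj x h2 _) i ?_ ?_
      · have : Tᶜ.card = m - T.card := by rw [Finset.card_compl, Fintype.card_fin]
        simp only [Module.finrank_fintype_fun_eq_card, Fintype.card_coe, this]
        omega
      · intro a
        set z := extendZero Tᶜ a with hz
        change (Q x *ᵥ z) ⬝ᵥ A x *ᵥ (Q x *ᵥ z) ≤ _ * ((Q x *ᵥ z) ⬝ᵥ (Q x *ᵥ z))
        rw [hform]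
        have h4 := (abs_le.1 (abs_dotProduct_mulVec_sub_diag_le (le_max_right C 0) h0 z)).2
        have h5 : ∑ i, ((Q x)ᵀ * A x * Q x) i i * z i ^ 2 ≤ max C 0 * (z ⬝ᵥ z) := by
          rw [dotProduct, Finset.mul_sum]
          refine Finset.sum_le_sum fun i _ => ?_
          rw [← sq]
          by_cases hi : i ∈ T
          · rw [hz, extendZero_of_notMem _ (by simpa using hi)]
            simp
          · exact mul_le_mul_of_nonneg_right (h1 i hi) (sq_nonneg _)
        have h6 : z = (Q x)⁻¹ *ᵥ (Q x *ᵥ z) := by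
          rw [mulVec_mulVec, Matrix.nonsing_inv_mul _ h2, one_mulVec]
        have h7 := mulVec_dotProduct_self_le h3 (Q x *ᵥ z)
        rw [← h6] at h7
        calc _ ≤ C1 * (z ⬝ᵥ z) := by rw [hC1def]; linarith
          _ ≤ C1 * ((m * (m * D ^ 2)) * ((Q x *ᵥ z) ⬝ᵥ (Q x *ᵥ z))) :=
            mul_le_mul_of_nonneg_left h7 hC1n
          _ = _ := by ring
    obtain ⟨x, h1, h2⟩ := (hb.and (htop.eventually_gt_atTop (C1 * (m * (m * D ^ 2))))).exists
    exact absurd h1 (not_le.2 h2)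
  · intro hi
    obtain ⟨D, hD⟩ := exists_eventually_abs_le hQ
    refine tendsto_atTop.2 fun R => ?_
    -- Nonnegativity is needed to multiply the bound on `Q z ⬝ᵥ Q z` by it.
    set R' := max R 0 with hR'
    -- The first summand pays for the norm of `Q`, the second for the off-diagonal entries.
    have hbig : ∀ᶠ x in l, ∀ i ∈ T,
        R' * (m * (m * D ^ 2)) + m * max C 0 ≤ ((Q x)ᵀ * A x * Q x) i i := by
      refine eventually_all.2 fun i => ?_
      by_cases hi : i ∈ T
      · exact ((hT i hi).eventually_ge_atTop _).mono fun x hx _ => hx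
      · exact Eventually.of_forall fun x h => absurd h hi
    filter_upwards [hC0, hbig, hdet, hD] with x h0 h1 h2 h3
    refine (le_max_left R 0).trans (le_eigenvalues₀ (hA x) ((Q x).mulVecLin ∘ₗ extendZero T)
      (hinj x h2 _) i (by simpa using hi) ?_)
    intro a
    set z := extendZero T a with hz
    change R' * ((Q x *ᵥ z) ⬝ᵥ (Q x *ᵥ z)) ≤ (Q x *ᵥ z) ⬝ᵥ A x *ᵥ (Q x *ᵥ z)
    rw [hform]
    have h4 := (abs_le.1 (abs_dotProduct_mulVec_sub_diag_le (le_max_right C 0) h0 z)).1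
    have h5 : (R' * (m * (m * D ^ 2)) + m * max C 0) * (z ⬝ᵥ z) ≤
        ∑ i, ((Q x)ᵀ * A x * Q x) i i * z i ^ 2 := by
      rw [dotProduct, Finset.mul_sum]
      refine Finset.sum_le_sum fun i _ => ?_
      rw [← sq]
      by_cases hi : i ∈ T
      · exact mul_le_mul_of_nonneg_right (h1 i hi) (sq_nonneg _)
      · rw [hz, extendZero_of_notMem _ hi]
        simp
    have h6 := mul_le_mul_of_nonneg_left (mulVec_dotProduct_self_le h3 z) (le_max_right R 0)
    rw [← hR'] at h6
    linarith

open scoped Classical in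
theorem card_tendsto_eigenvalues₀ [l.NeBot] (hA : ∀ x, (A x).IsHermitian)
    {Q₀ : Matrix (Fin m) (Fin m) ℝ} (hQ : Tendsto Q l (𝓝 Q₀)) (hQ₀ : IsUnit Q₀.det)
    (T : Finset (Fin m)) {C : ℝ}
    (hT : ∀ i ∈ T, Tendsto (fun x => ((Q x)ᵀ * A x * Q x) i i) l atTop)
    (hT' : ∀ i ∉ T, ∀ᶠ x in l, ((Q x)ᵀ * A x * Q x) i i ≤ C)
    (hoff : ∀ i j, i ≠ j → ∀ᶠ x in l, |((Q x)ᵀ * A x * Q x) i j| ≤ C) :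
    (Finset.univ.filter fun i => Tendsto (fun x => (hA x).eigenvalues₀ i) l atTop).card =
      T.card := by
  simp only [tendsto_eigenvalues₀_iff hA hQ hQ₀ T hT hT' hoff]
  have h1 : T.card ≤ Fintype.card (Fin m) := Finset.card_le_univ T
  generalize Fintype.card (Fin m) = N at h1
  have h2 := Fin.card_filter_val_lt (n := N) (m := T.card)
  rw [min_eq_right h1] at h2
  convert h2

end Count

/-! ### Laurent expansion of rational functions and polynomial approximation of bases -/

section Embedding

open Module

variable {K : Type*} [Field K]

theorem le_comap_nonZeroDivisors {R S : Type*} [CommRing R] [CommRing S] [IsDomain S]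
    {f : R →+* S} (hf : Function.Injective f) :
    nonZeroDivisors R ≤ (nonZeroDivisors S).comap f :=
  nonZeroDivisors_le_comap_nonZeroDivisors_of_injective f hf

variable (K) in
theorem algebraMap_comp_coe_injective : Function.Injective
    ((algebraMap (PowerSeries K) (LaurentSeries K)).comp
      (Polynomial.coeToPowerSeries.ringHom (R := K))) :=
  (IsFractionRing.injective (PowerSeries K) (LaurentSeries K)).comp
    (Polynomial.coe_injective K)

variable (K) in
/-- The Laurent expansion at `0` of a rational function. -/
def laurentExpansion : RatFunc K →+* LaurentSeries K :=
  RatFunc.liftRingHom _ (le_comap_nonZeroDivisors (algebraMap_comp_coe_injective K))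

theorem laurentExpansion_polynomial (p : K[X]) :
    laurentExpansion K (algebraMap K[X] (RatFunc K) p) =
      algebraMap (PowerSeries K) (LaurentSeries K) (p : PowerSeries K) :=
  RatFunc.liftRingHom_algebraMap _ _ _

theorem laurentExpansion_X_pow (n : ℕ) :
    laurentExpansion K (RatFunc.X ^ n) = HahnSeries.single (n : ℤ) 1 := by
  rw [map_pow, ← HahnSeries.ofPowerSeries_X_pow, ← LaurentSeries.coe_algebraMap, map_pow,
    ← RatFunc.algebraMap_X, laurentExpansion_polynomial, Polynomial.coe_X]

theorem order_leadingCoeff_polynomial {p : K[X]} (hp : p.eval 0 ≠ 0) :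
    (laurentExpansion K (algebraMap K[X] (RatFunc K) p)).order = 0 ∧
    (laurentExpansion K (algebraMap K[X] (RatFunc K) p)).leadingCoeff = p.eval 0 := by
  have h0 : (laurentExpansion K (algebraMap K[X] (RatFunc K) p)).coeff 0 = p.eval 0 := by
    rw [laurentExpansion_polynomial, LaurentSeries.coe_algebraMap]
    have := LaurentSeries.coeff_coe_powerSeries (p : PowerSeries K) 0
    rw [Nat.cast_zero] at this
    rw [this, Polynomial.coeff_coe, Polynomial.coeff_zero_eq_eval_zero]
  have h1 : (laurentExpansion K (algebraMap K[X] (RatFunc K) p)).order = 0 := by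
    apply le_antisymm
    · exact HahnSeries.order_le_of_coeff_ne_zero (by rwa [h0])
    · by_contra h
      have h2 := (exists_powerSeries_iff (K := K)).1 ⟨_, (laurentExpansion_polynomial p).symm⟩ _
        (not_le.1 h)
      rw [HahnSeries.coeff_order_eq_zero] at h2
      rw [h2] at h0
      exact hp h0.symm
  exact ⟨h1, by rw [HahnSeries.leadingCoeff_eq, h1, h0]⟩

/-- The relation `f = t ^ (a - b) * p / q` in a form free of division, from which order and leading
coefficient are read off. Shifts to finite places and the substitution at infinity both produce
relations of this shape. -/
theorem order_leadingCoeff_of_mul_eq {f : RatFunc K} {p q : K[X]} {a b : ℕ} (hp : p.eval 0 ≠ 0)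
    (hq : q.eval 0 ≠ 0) (h : f * (RatFunc.X ^ b * algebraMap K[X] (RatFunc K) q) =
      RatFunc.X ^ a * algebraMap K[X] (RatFunc K) p) :
    (laurentExpansion K f).order = (a : ℤ) - b ∧
    (laurentExpansion K f).leadingCoeff = p.eval 0 / q.eval 0 := by
  have h1 := congrArg (laurentExpansion K) h
  obtain ⟨p1, p2⟩ := order_leadingCoeff_polynomial hp
  obtain ⟨q1, q2⟩ := order_leadingCoeff_polynomial hq
  have hp0 : laurentExpansion K (algebraMap K[X] (RatFunc K) p) ≠ 0 := fun h => by
    rw [h, HahnSeries.leadingCoeff_zero] at p2; exact hp p2.symm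
  have hq0 : laurentExpansion K (algebraMap K[X] (RatFunc K) q) ≠ 0 := fun h => by
    rw [h, HahnSeries.leadingCoeff_zero] at q2; exact hq q2.symm
  rw [map_mul, map_mul, map_mul, laurentExpansion_X_pow, laurentExpansion_X_pow] at h1
  have hs : ∀ n : ℕ, (HahnSeries.single (n : ℤ) (1 : K)) ≠ 0 := fun n =>
    HahnSeries.single_ne_zero one_ne_zero
  have hf0 : laurentExpansion K f ≠ 0 := fun h => by
    rw [h, zero_mul] at h1
    exact mul_ne_zero (hs a) hp0 h1.symm
  have h2 := congrArg HahnSeries.order h1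
  rw [HahnSeries.order_mul hf0 (mul_ne_zero (hs b) hq0), HahnSeries.order_mul (hs b) hq0,
    HahnSeries.order_mul (hs a) hp0, p1, q1, HahnSeries.order_single one_ne_zero,
    HahnSeries.order_single one_ne_zero] at h2
  have h3 := congrArg HahnSeries.leadingCoeff h1
  rw [HahnSeries.leadingCoeff_mul, HahnSeries.leadingCoeff_mul, HahnSeries.leadingCoeff_mul, p2,
    q2, HahnSeries.leadingCoeff_of_single, HahnSeries.leadingCoeff_of_single, one_mul,
    one_mul] at h3
  exact ⟨by omega, by rw [← h3, mul_div_cancel_right₀ _ hq]⟩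

theorem exists_X_pow_mul {p : K[X]} (hp : p ≠ 0) :
    ∃ (a : ℕ) (p' : K[X]), p'.eval 0 ≠ 0 ∧ p = X ^ a * p' := by
  obtain ⟨q, hq, hq'⟩ := p.exists_eq_pow_rootMultiplicity_mul_and_not_dvd hp 0
  rw [C_0, sub_zero] at hq hq'
  refine ⟨_, q, ?_, hq⟩
  rwa [← Polynomial.coeff_zero_eq_eval_zero, Ne, ← Polynomial.X_dvd_iff]

/-- A rational function is `t ^ (a - b)` times a rational function that is regular and nonzero
at `0`. -/
theorem exists_order_leadingCoeff {f : RatFunc K} (hf : f ≠ 0) :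
    ∃ (a b : ℕ) (p q : K[X]), p.eval 0 ≠ 0 ∧ q.eval 0 ≠ 0 ∧
      f * (RatFunc.X ^ b * algebraMap K[X] (RatFunc K) q) =
        RatFunc.X ^ a * algebraMap K[X] (RatFunc K) p := by
  obtain ⟨a, p, hp, hp'⟩ := exists_X_pow_mul (RatFunc.num_ne_zero hf)
  obtain ⟨b, q, hq, hq'⟩ := exists_X_pow_mul f.denom_ne_zero
  refine ⟨a, b, p, q, hp, hq, ?_⟩
  have h1 := RatFunc.num_div_denom f
  rw [div_eq_iff (RatFunc.algebraMap_ne_zero f.denom_ne_zero)] at h1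
  rw [← RatFunc.algebraMap_X, ← map_pow, ← map_pow, ← map_mul, ← map_mul, ← hp', ← hq', h1]

/-- A regular error leaves the principal part unchanged, so approximate diagonalization suffices.
Without a pole of `g` only the regularity of `f` survives, not its leading coefficient. -/
theorem poleOrder_eq_of_sub_mem {f g : LaurentSeries K} (h : f - g ∈ polesLE K 0)
    (hg : 0 < poleOrder g) : poleOrder f = poleOrder g ∧ f.leadingCoeff = g.leadingCoeff := by
  have h1 := poleOrder_le_iff_coeff.1 (mem_polesLE_iff.1 h)
  have h2 : ∀ n < 0, f.coeff n = g.coeff n := fun n hn => by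
    have := h1 n (by simpa using hn)
    rwa [HahnSeries.coeff_sub, sub_eq_zero] at this
  have hg0 : g ≠ 0 := fun h => by simp [h] at hg
  have hgo : g.order < 0 := by unfold poleOrder at hg; omega
  have hf : f.coeff g.order ≠ 0 := by
    rw [h2 _ hgo]
    exact mt HahnSeries.coeff_order_eq_zero.1 hg0
  have hf0 : f ≠ 0 := fun h => by simp [h] at hf
  have h3 : f.order ≤ g.order := HahnSeries.order_le_of_coeff_ne_zero hf
  have h4 : g.order ≤ f.order := by
    apply HahnSeries.order_le_of_coeff_ne_zero
    rw [← h2 _ (by omega)]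
    exact mt HahnSeries.coeff_order_eq_zero.1 hf0
  have h5 := le_antisymm h3 h4
  refine ⟨by rw [poleOrder, h5]; rfl, ?_⟩
  rw [HahnSeries.leadingCoeff_eq, HahnSeries.leadingCoeff_eq, h5, h2 _ hgo]

theorem exists_eq_trunc_add (n : ℕ) (f : PowerSeries K) :
    ∃ r, f = (PowerSeries.trunc n f : PowerSeries K) + PowerSeries.X ^ n * r := by
  have : PowerSeries.X ^ n ∣ f - (PowerSeries.trunc n f : PowerSeries K) := by
    rw [PowerSeries.X_pow_dvd_iff]
    intro m hm
    rw [map_sub, Polynomial.coeff_coe, PowerSeries.coeff_trunc, if_pos hm, sub_self]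
  obtain ⟨r, hr⟩ := this
  exact ⟨r, by rw [← hr]; ring⟩

/-- A diagonalizing basis over the power series ring can be replaced by a polynomial congruence,
up to an error that is regular at `0`. -/
theorem exists_polynomial_congruence {m : ℕ} (H : Matrix (Fin m) (Fin m) (RatFunc K))
    (b : Basis (Fin m) (PowerSeries K) (Fin m → PowerSeries K)) :
    ∃ Q : Matrix (Fin m) (Fin m) K[X], IsUnit (Q.map (eval 0)).det ∧
      ∀ i j, laurentExpansion K (((Q.map (algebraMap K[X] (RatFunc K)))ᵀ * H *
        Q.map (algebraMap K[X] (RatFunc K))) i j) -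
          pairing (H.map (laurentExpansion K)) (b i) (b j) ∈ polesLE K 0 := by
  set B := pairing (H.map (laurentExpansion K)) with hB
  obtain ⟨N, hN⟩ : ∃ N, ∀ x y, B x y ∈ polesLE K N := by
    refine ⟨∑ i, ∑ j, poleOrder (H.map (laurentExpansion K) i j), fun x y => ?_⟩
    rw [hB, pairing_apply]
    refine Submodule.sum_mem _ fun i _ => Submodule.smul_mem _ _ (Submodule.sum_mem _ fun j _ =>
      Submodule.smul_mem _ _ (mem_polesLE_iff.2 ?_))
    exact (Finset.single_le_sum
      (f := fun j => poleOrder (H.map (laurentExpansion K) i j)) (fun _ _ => Nat.zero_le _)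
      (Finset.mem_univ j)).trans (Finset.single_le_sum
      (f := fun i => ∑ j, poleOrder (H.map (laurentExpansion K) i j)) (fun _ _ => Nat.zero_le _)
      (Finset.mem_univ i))
  have hN' : ∀ x y, (PowerSeries.X ^ (N + 1) : PowerSeries K) • B x y ∈ polesLE K 0 := fun x y => by
    obtain ⟨r, hr⟩ := mem_polesLE.1 (hN x y)
    refine mem_polesLE.2 ⟨PowerSeries.X * r, ?_⟩
    rw [map_mul, hr, pow_zero, one_smul, pow_succ', mul_smul, Algebra.smul_def PowerSeries.X]
  -- All values of `B` have poles of order at most `N`, so changing the basis by multiples of `t ^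
  -- (N + 1)` changes them by regular terms. Since `N + 1` is positive, the constant terms survive,
  -- and with them invertibility at `0`.
  set q : Fin m → Fin m → PowerSeries K :=
    fun i j => (PowerSeries.trunc (N + 1) (b i j) : PowerSeries K) with hq
  obtain ⟨r, hr⟩ : ∃ r : Fin m → Fin m → PowerSeries K,
      ∀ i, q i = b i - (PowerSeries.X ^ (N + 1) : PowerSeries K) • r i := by
    choose r hr using fun i j => exists_eq_trunc_add (N + 1) (b i j)
    refine ⟨r, fun i => funext fun j => ?_⟩
    rw [Pi.sub_apply, Pi.smul_apply, smul_eq_mul]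
    conv_rhs => rw [hr i j]
    simp [hq]
  refine ⟨Matrix.of fun j i => PowerSeries.trunc (N + 1) (b i j), ?_, fun i j => ?_⟩
  · have h1 : IsUnit ((Pi.basisFun (PowerSeries K) (Fin m)).toMatrix b).det := by
      have := (Pi.basisFun (PowerSeries K) (Fin m)).invertibleToMatrix b
      exact (Matrix.isUnit_iff_isUnit_det _).1 (isUnit_of_invertible _)
    have h2 := h1.map (PowerSeries.constantCoeff (R := K))
    rw [RingHom.map_det] at h2
    convert h2 using 2
    refine Matrix.ext fun j i => ?_
    simp only [Matrix.map_apply, Matrix.of_apply, RingHom.mapMatrix_apply]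
    rw [← Polynomial.coeff_zero_eq_eval_zero, PowerSeries.coeff_trunc, if_pos (Nat.succ_pos _)]
    simp [Basis.toMatrix_apply]
  · have h1 : laurentExpansion K
        ((((Matrix.of fun j i => PowerSeries.trunc (N + 1) (b i j)).map
          (algebraMap K[X] (RatFunc K)))ᵀ * H *
          (Matrix.of fun j i => PowerSeries.trunc (N + 1) (b i j)).map
            (algebraMap K[X] (RatFunc K))) i j) = B (q i) (q j) := by
      rw [hB, pairing_eq_dotProduct, dotProduct_mulVec]
      simp only [Matrix.mul_apply, map_sum, map_mul, Matrix.transpose_apply, Matrix.map_apply,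
        Matrix.of_apply, laurentExpansion_polynomial, dotProduct, vecMul, Function.comp, hq]
    rw [h1, hr i, hr j]
    simp only [map_sub, map_smul, LinearMap.sub_apply, LinearMap.smul_apply]
    have h2 : B (b i) (b j) - (PowerSeries.X ^ (N + 1) : PowerSeries K) • B (r i) (b j) -
        (PowerSeries.X ^ (N + 1) : PowerSeries K) • (B (b i) (r j) -
          (PowerSeries.X ^ (N + 1) : PowerSeries K) • B (r i) (r j)) - B (b i) (b j) =
        -((PowerSeries.X ^ (N + 1) : PowerSeries K) • B (r i) (b j)) -
        ((PowerSeries.X ^ (N + 1) : PowerSeries K) • B (b i) (r j)) +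
        (PowerSeries.X ^ (N + 1) : PowerSeries K) • ((PowerSeries.X ^ (N + 1) : PowerSeries K) •
          B (r i) (r j)) := by
      rw [smul_sub]; ring
    rw [h2]
    exact Submodule.add_mem _ (Submodule.sub_mem _ (Submodule.neg_mem _ (hN' _ _)) (hN' _ _))
      (Submodule.smul_mem _ _ (hN' _ _))

end Embedding

/-! ### Asymptotics of rational functions on one side of `0` -/

section Eval

variable {l : Filter ℝ}

theorem eventually_eval_ne_zero (hl : l ≤ cofinite) {p : ℝ[X]} (hp : p ≠ 0) :
    ∀ᶠ x in l, p.eval x ≠ 0 := by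
  refine hl ?_
  refine (p.roots.toFinset.finite_toSet).subset fun x hx => ?_
  simpa [hp] using hx

/-- `RatFunc.eval` has the junk value `0` at a pole, so evaluation is additive only away from the
zeros of the denominators. Along a filter below `cofinite` these finitely many points are invisible.
-/
theorem eventually_eval_add (hl : l ≤ cofinite) (f g : RatFunc ℝ) :
    ∀ᶠ x in l, (f + g).eval (RingHom.id ℝ) x =
      f.eval (RingHom.id ℝ) x + g.eval (RingHom.id ℝ) x := by
  filter_upwards [eventually_eval_ne_zero hl f.denom_ne_zero,
    eventually_eval_ne_zero hl g.denom_ne_zero] with x h1 h2 using RatFunc.eval_add _ _ h1 h2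

theorem eventually_eval_mul (hl : l ≤ cofinite) (f g : RatFunc ℝ) :
    ∀ᶠ x in l, (f * g).eval (RingHom.id ℝ) x =
      f.eval (RingHom.id ℝ) x * g.eval (RingHom.id ℝ) x := by
  filter_upwards [eventually_eval_ne_zero hl f.denom_ne_zero,
    eventually_eval_ne_zero hl g.denom_ne_zero] with x h1 h2 using RatFunc.eval_mul _ _ h1 h2

theorem eval_polynomial (p : ℝ[X]) (x : ℝ) :
    (algebraMap ℝ[X] (RatFunc ℝ) p).eval (RingHom.id ℝ) x = p.eval x := by
  rw [RatFunc.eval_algebraMap]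
  rfl

theorem eventually_eval_sum (hl : l ≤ cofinite) {ι : Type*} (s : Finset ι) (f : ι → RatFunc ℝ) :
    ∀ᶠ x in l, (∑ i ∈ s, f i).eval (RingHom.id ℝ) x = ∑ i ∈ s, (f i).eval (RingHom.id ℝ) x := by
  classical
  induction s using Finset.induction_on with
  | empty => exact Eventually.of_forall fun x => by simp
  | insert a s ha ih =>
    rw [Finset.sum_insert ha]
    filter_upwards [ih, eventually_eval_add hl (f a) (∑ i ∈ s, f i)] with x h1 h2
    rw [h2, h1, Finset.sum_insert ha]

theorem eventually_evalAt_mul (hl : l ≤ cofinite) {m n k : ℕ}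
    (A : Matrix (Fin m) (Fin n) (RatFunc ℝ)) (B : Matrix (Fin n) (Fin k) (RatFunc ℝ)) :
    ∀ᶠ x in l, evalAt (A * B) x = evalAt A x * evalAt B x := by
  have h1 : ∀ i j, ∀ᶠ x in l, evalAt (A * B) x i j = (evalAt A x * evalAt B x) i j := fun i j => by
    have h2 : ∀ᶠ x in l, ∀ k, (A i k * B k j).eval (RingHom.id ℝ) x =
      (A i k).eval (RingHom.id ℝ) x * (B k j).eval (RingHom.id ℝ) x :=
      eventually_all.2 fun k => eventually_eval_mul hl _ _
    filter_upwards [eventually_eval_sum hl Finset.univ fun k => A i k * B k j, h2] with x h3 h4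
    simp only [evalAt, Matrix.map_apply, Matrix.mul_apply]
    rw [h3]
    exact Finset.sum_congr rfl fun k _ => h4 k
  filter_upwards [eventually_all.2 fun i => eventually_all.2 (h1 i)] with x hx
  exact Matrix.ext hx

/-- A one-sided punctured neighbourhood of `0`, on the side of the sign `ε`. -/
structure IsSide (l : Filter ℝ) (ε : ℝ) : Prop where
  sq_eq_one : ε * ε = 1
  le_nhds : l ≤ 𝓝 0
  eventually_pos : ∀ᶠ x in l, 0 < ε * x

theorem isSide_right : IsSide (𝓝[>] 0) 1 :=
  ⟨by norm_num, nhdsWithin_le_nhds, by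
    filter_upwards [self_mem_nhdsWithin] with x hx using by simpa using hx⟩

theorem isSide_left : IsSide (𝓝[<] 0) (-1) :=
  ⟨by norm_num, nhdsWithin_le_nhds, by
    filter_upwards [self_mem_nhdsWithin] with x hx using by simpa using hx⟩

namespace IsSide

variable {ε : ℝ}

theorem eventually_ne (h : IsSide l ε) : ∀ᶠ x in l, x ≠ 0 :=
  h.eventually_pos.mono fun x hx h0 => by simp [h0] at hx

theorem le_cofinite (h : IsSide l ε) : l ≤ cofinite := by
  refine le_trans ?_ (nhdsNE_le_cofinite (0 : ℝ))
  exact le_inf h.le_nhds (le_principal_iff.2 h.eventually_ne)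

theorem tendsto_eval (h : IsSide l ε) (p : ℝ[X]) :
    Tendsto (fun x => p.eval x) l (𝓝 (p.eval 0)) :=
  (p.continuous.tendsto 0).mono_left h.le_nhds

theorem eventually_eval_mul_pow (h : IsSide l ε) {f : RatFunc ℝ} {p q : ℝ[X]} {a b : ℕ}
    (hq : q.eval 0 ≠ 0) (hf : f * (RatFunc.X ^ b * algebraMap ℝ[X] (RatFunc ℝ) q) =
      RatFunc.X ^ a * algebraMap ℝ[X] (RatFunc ℝ) p) :
    ∀ᶠ x in l, f.eval (RingHom.id ℝ) x = x ^ a / x ^ b * (p.eval x / q.eval x) := by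
  have hq0 : ∀ᶠ x in l, q.eval x ≠ 0 := (h.tendsto_eval q).eventually_ne hq
  rw [← RatFunc.algebraMap_X, ← map_pow, ← map_pow, ← map_mul, ← map_mul] at hf
  filter_upwards [hq0, h.eventually_ne, eventually_eval_mul h.le_cofinite f
    (algebraMap ℝ[X] (RatFunc ℝ) (X ^ b * q))] with x h1 h2 h3
  rw [hf, eval_polynomial, eval_polynomial] at h3
  simp only [eval_mul, eval_pow, eval_X] at h3
  field_simp
  linarith

theorem exists_abs_eval_le (h : IsSide l ε) {f : RatFunc ℝ}
    (hf : poleOrder (laurentExpansion ℝ f) = 0) :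
    ∃ C, ∀ᶠ x in l, |f.eval (RingHom.id ℝ) x| ≤ C := by
  by_cases h0 : f = 0
  · exact ⟨0, Eventually.of_forall fun x => by simp [h0]⟩
  obtain ⟨a, b, p, q, hp, hq, hfe⟩ := exists_order_leadingCoeff h0
  have h1 := (order_leadingCoeff_of_mul_eq hp hq hfe).1
  have hab : b ≤ a := by unfold poleOrder at hf; omega
  have h2 : Tendsto (fun x => |x ^ (a - b) * (p.eval x / q.eval x)|) l
      (𝓝 |0 ^ (a - b) * (p.eval 0 / q.eval 0)|) :=
    ((((continuous_pow (a - b)).tendsto (0 : ℝ)).mono_left h.le_nhds).mul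
      ((h.tendsto_eval p).div (h.tendsto_eval q) hq)).abs
  refine ⟨|0 ^ (a - b) * (p.eval 0 / q.eval 0)| + 1, ?_⟩
  filter_upwards [h.eventually_eval_mul_pow hq hfe, h.eventually_ne,
    h2.eventually (gt_mem_nhds (lt_add_one _))] with x h3 h4 h5
  rw [h3, div_eq_mul_inv (x ^ a), ← pow_sub₀ _ h4 hab]
  exact h5.le

theorem tendsto_inv_pow (h : IsSide l ε) {n : ℕ} (hn : n ≠ 0) :
    Tendsto (fun x => ((ε * x) ^ n)⁻¹) l atTop := by
  refine tendsto_inv_nhdsGT_zero.comp ?_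
  refine tendsto_nhdsWithin_iff.2 ⟨?_, h.eventually_pos.mono fun x hx => pow_pos hx n⟩
  have : Tendsto (fun x : ℝ => (ε * x) ^ n) (𝓝 0) (𝓝 ((ε * 0) ^ n)) :=
    (by fun_prop : Continuous fun x : ℝ => (ε * x) ^ n).tendsto 0
  rw [mul_zero, zero_pow hn] at this
  exact this.mono_left h.le_nhds

/-- As `ε² = 1`, `x ^ (-N) = ε ^ N * (ε x) ^ (-N)`, and `ε x` is positive on the chosen side. The
sign of the infinite limit is therefore that of `ε ^ N` times the leading coefficient. -/
theorem exists_eventually_eval_eq (h : IsSide l ε) {f : RatFunc ℝ}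
    (hf : 0 < poleOrder (laurentExpansion ℝ f)) :
    ∃ g : ℝ → ℝ, Tendsto g l (𝓝 (ε ^ poleOrder (laurentExpansion ℝ f) *
      (laurentExpansion ℝ f).leadingCoeff)) ∧ ∀ᶠ x in l, f.eval (RingHom.id ℝ) x =
        ((ε * x) ^ poleOrder (laurentExpansion ℝ f))⁻¹ * g x := by
  have h0 : f ≠ 0 := fun h => by simp [h] at hf
  obtain ⟨a, b, p, q, hp, hq, hfe⟩ := exists_order_leadingCoeff h0
  obtain ⟨h1, h1'⟩ := order_leadingCoeff_of_mul_eq hp hq hfe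
  have hb : b = a + poleOrder (laurentExpansion ℝ f) := by unfold poleOrder at hf ⊢; omega
  rw [h1']
  generalize poleOrder (laurentExpansion ℝ f) = n at hb
  refine ⟨fun x => ε ^ n * (p.eval x / q.eval x),
    ((h.tendsto_eval p).div (h.tendsto_eval q) hq).const_mul _, ?_⟩
  filter_upwards [h.eventually_eval_mul_pow hq hfe, h.eventually_ne] with x h3 h4
  have hε : ε ≠ 0 := fun h' => by have := h.sq_eq_one; simp [h'] at this
  rw [h3, hb, pow_add, mul_pow]
  field_simp

theorem tendsto_eval_atTop (h : IsSide l ε) {f : RatFunc ℝ}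
    (hf : 0 < poleOrder (laurentExpansion ℝ f))
    (hpos : 0 < ε ^ poleOrder (laurentExpansion ℝ f) * (laurentExpansion ℝ f).leadingCoeff) :
    Tendsto (fun x => f.eval (RingHom.id ℝ) x) l atTop := by
  obtain ⟨g, hg, he⟩ := h.exists_eventually_eval_eq hf
  exact ((h.tendsto_inv_pow hf.ne').atTop_mul_pos hpos hg).congr' (he.mono fun x hx => hx.symm)

theorem exists_eval_le (h : IsSide l ε) {f : RatFunc ℝ}
    (hf : ¬ (0 < poleOrder (laurentExpansion ℝ f) ∧
      0 < ε ^ poleOrder (laurentExpansion ℝ f) * (laurentExpansion ℝ f).leadingCoeff)) :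
    ∃ C, ∀ᶠ x in l, f.eval (RingHom.id ℝ) x ≤ C := by
  by_cases h0 : poleOrder (laurentExpansion ℝ f) = 0
  · obtain ⟨C, hC⟩ := h.exists_abs_eval_le h0
    exact ⟨C, hC.mono fun x hx => (le_abs_self _).trans hx⟩
  · have h1 : 0 < poleOrder (laurentExpansion ℝ f) := Nat.pos_of_ne_zero h0
    have hε : ε ≠ 0 := fun h' => by have := h.sq_eq_one; simp [h'] at this
    have hlc : (laurentExpansion ℝ f).leadingCoeff ≠ 0 := fun h2 => by
      rw [HahnSeries.leadingCoeff_eq_zero] at h2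
      simp [h2] at h0
    have hneg : ε ^ poleOrder (laurentExpansion ℝ f) * (laurentExpansion ℝ f).leadingCoeff < 0 :=
      lt_of_le_of_ne (not_lt.1 fun h2 => hf ⟨h1, h2⟩) (mul_ne_zero (pow_ne_zero _ hε) hlc)
    obtain ⟨g, hg, he⟩ := h.exists_eventually_eval_eq h1
    have := ((h.tendsto_inv_pow h1.ne').atTop_mul_neg hneg hg).congr' (he.mono fun x hx => hx.symm)
    exact ⟨0, this.eventually_le_atBot 0⟩

end IsSide

end Eval

/-! ### Net jumps at `0` as the signature of the residue form -/

section Count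

open Module

variable {l : Filter ℝ} {ε : ℝ}

open scoped Classical in
/-- The number of eigenvalues that tend to `+∞` on one side of `0`, in terms of a diagonalization
over the power series ring. -/
theorem countToTop_eq [l.NeBot] (hl : IsSide l ε) {m : ℕ}
    {H : Matrix (Fin m) (Fin m) (RatFunc ℝ)} (hH : H.IsSymm)
    {b : Basis (Fin m) (PowerSeries ℝ) (Fin m → PowerSeries ℝ)}
    (hb : IsOrthogonalBasis (H.map (laurentExpansion ℝ)) b) :
    countToTop H hH l = (Finset.univ.filter fun i =>
      0 < poleOrder (pairing (H.map (laurentExpansion ℝ)) (b i) (b i)) ∧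
      0 < ε ^ poleOrder (pairing (H.map (laurentExpansion ℝ)) (b i) (b i)) *
        (pairing (H.map (laurentExpansion ℝ)) (b i) (b i)).leadingCoeff).card := by
  -- The basis `b` is only formal; its polynomial truncation `Q` can be evaluated near `0` and still
  -- diagonalizes `H` up to bounded terms.
  obtain ⟨Q, hQ, hQM⟩ := exists_polynomial_congruence H b
  set T := Finset.univ.filter fun i =>
      0 < poleOrder (pairing (H.map (laurentExpansion ℝ)) (b i) (b i)) ∧
      0 < ε ^ poleOrder (pairing (H.map (laurentExpansion ℝ)) (b i) (b i)) *
        (pairing (H.map (laurentExpansion ℝ)) (b i) (b i)).leadingCoeff with hT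
  set R := Q.map (algebraMap ℝ[X] (RatFunc ℝ)) with hR
  set M := Rᵀ * H * R with hM
  have hRe : ∀ x, evalAt R x = Q.map (eval x) := fun x =>
    Matrix.ext fun i j => eval_polynomial (Q i j) x
  have hRt : ∀ x, evalAt Rᵀ x = (Q.map (eval x))ᵀ := fun x =>
    Matrix.ext fun i j => eval_polynomial (Q j i) x
  have hMe : ∀ᶠ x in l, evalAt M x = (Q.map (eval x))ᵀ * evalAt H x * Q.map (eval x) := by
    filter_upwards [eventually_evalAt_mul hl.le_cofinite (Rᵀ * H) R,
      eventually_evalAt_mul hl.le_cofinite Rᵀ H] with x h1 h2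
    rw [hM, h1, h2, hRe, hRt]
  have hQt : Tendsto (fun x => Q.map (eval x)) l (𝓝 (Q.map (eval 0))) :=
    tendsto_pi_nhds.2 fun i => tendsto_pi_nhds.2 fun j => hl.tendsto_eval (Q i j)
  have hdiag : ∀ i, 0 < poleOrder (pairing (H.map (laurentExpansion ℝ)) (b i) (b i)) →
      poleOrder (laurentExpansion ℝ (M i i)) =
        poleOrder (pairing (H.map (laurentExpansion ℝ)) (b i) (b i)) ∧
      (laurentExpansion ℝ (M i i)).leadingCoeff =
        (pairing (H.map (laurentExpansion ℝ)) (b i) (b i)).leadingCoeff :=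
    fun i hi => poleOrder_eq_of_sub_mem (hQM i i) hi
  have hT1 : ∀ i ∈ T, Tendsto (fun x => (M i i).eval (RingHom.id ℝ) x) l atTop := fun i hi => by
    rw [hT, Finset.mem_filter] at hi
    obtain ⟨h1, h2⟩ := hdiag i hi.2.1
    apply hl.tendsto_eval_atTop <;> rw [h1]
    · exact hi.2.1
    · rw [h2]; exact hi.2.2
  have hT2 : ∀ i, ∃ C, i ∉ T → ∀ᶠ x in l, (M i i).eval (RingHom.id ℝ) x ≤ C := fun i => by
    by_cases hi : i ∈ T
    · exact ⟨0, fun h => absurd hi h⟩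
    have : ∃ C, ∀ᶠ x in l, (M i i).eval (RingHom.id ℝ) x ≤ C := by
      apply hl.exists_eval_le
      rintro ⟨h1, h2⟩
      have h3 : 0 < poleOrder (pairing (H.map (laurentExpansion ℝ)) (b i) (b i)) := by
        by_contra h3
        have h4 : pairing (H.map (laurentExpansion ℝ)) (b i) (b i) ∈ polesLE ℝ 0 :=
          mem_polesLE_iff.2 (by omega)
        have h5 := Submodule.add_mem _ (hQM i i) h4
        rw [sub_add_cancel, mem_polesLE_iff] at h5
        omega
      obtain ⟨h4, h5⟩ := hdiag i h3
      rw [h4, h5] at h2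
      exact hi (Finset.mem_filter.2 ⟨Finset.mem_univ _, h3, h2⟩)
    exact ⟨this.choose, fun _ => this.choose_spec⟩
  have hoff : ∀ p : Fin m × Fin m, ∃ C, p.1 ≠ p.2 →
      ∀ᶠ x in l, |(M p.1 p.2).eval (RingHom.id ℝ) x| ≤ C := fun ⟨i, j⟩ => by
    by_cases hij : i = j
    · exact ⟨0, fun h => absurd hij h⟩
    have h1 := hQM i j
    rw [hb i j hij, sub_zero, mem_polesLE_iff] at h1
    have := hl.exists_abs_eval_le (Nat.le_zero.1 h1)
    exact ⟨this.choose, fun _ => this.choose_spec⟩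
  choose C1 hC1 using hT2
  choose C2 hC2 using hoff
  have hC : ∃ C, (∀ i, C1 i ≤ C) ∧ ∀ p, C2 p ≤ C := by
    obtain ⟨c1, hc1⟩ := (Set.finite_range C1).bddAbove
    obtain ⟨c2, hc2⟩ := (Set.finite_range C2).bddAbove
    exact ⟨max c1 c2, fun i => (hc1 ⟨i, rfl⟩).trans (le_max_left _ _),
      fun i => (hc2 ⟨i, rfl⟩).trans (le_max_right _ _)⟩
  obtain ⟨C, hC1', hC2'⟩ := hC
  have hentry : ∀ i j, ∀ᶠ x in l, (M i j).eval (RingHom.id ℝ) x =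
      ((Q.map (eval x))ᵀ * evalAt H x * Q.map (eval x)) i j := fun i j =>
    hMe.mono fun x hx => by rw [← hx]; rfl
  exact card_tendsto_eigenvalues₀ (fun x => isHermitian_evalAt hH x) hQt hQ T
    (fun i hi => (hT1 i hi).congr' (hentry i i))
    (fun i hi => by
      filter_upwards [hC1 i hi, hentry i i] with x h1 h2
      rw [← h2]; exact h1.trans (hC1' i))
    (fun i j hij => by
      filter_upwards [hC2 (i, j) hij, hentry i j] with x h1 h2
      rw [← h2]; exact h1.trans (hC2' _))

/-- The net number of jumps at `0` is the signature of the residue form. -/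
theorem netJumps_zero {m : ℕ} {H : Matrix (Fin m) (Fin m) (RatFunc ℝ)} (hH : H.IsSymm)
    {b : Basis (Fin m) (PowerSeries ℝ) (Fin m → PowerSeries ℝ)}
    (hb : IsOrthogonalBasis (H.map (laurentExpansion ℝ)) b) :
    netJumps H hH (𝓝[<] 0) (𝓝[>] 0) =
      ∑ i, (posIndex (pairing (H.map (laurentExpansion ℝ)) (b i) (b i)) : ℤ) -
      ∑ i, (negIndex (pairing (H.map (laurentExpansion ℝ)) (b i) (b i)) : ℤ) := by
  classical
  rw [netJumps, countToTop_eq isSide_right hH hb, countToTop_eq isSide_left hH hb,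
    Finset.card_filter, Finset.card_filter, Nat.cast_sum, Nat.cast_sum, ← Finset.sum_sub_distrib,
    ← Finset.sum_sub_distrib]
  refine Finset.sum_congr rfl fun i _ => ?_
  generalize pairing (H.map (laurentExpansion ℝ)) (b i) (b i) = f
  rw [one_pow, one_mul]
  by_cases h0 : poleOrder f = 0
  · simp [posIndex, negIndex, h0]
  have hlc : f.leadingCoeff ≠ 0 := fun h2 => by
    rw [HahnSeries.leadingCoeff_eq_zero] at h2
    simp [h2] at h0
  have h1 : 0 < poleOrder f := Nat.pos_of_ne_zero h0
  simp only [h1, true_and, posIndex, negIndex]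
  -- At a pole of even order both one-sided limits agree and the two indices are equal. At one of
  -- odd order the limits are opposite, and both the jump and the difference of the indices are the
  -- sign of the leading coefficient.
  rcases Nat.even_or_odd (poleOrder f) with he | ho
  · rw [he.neg_one_pow, one_mul]
    obtain ⟨k, hk⟩ := he
    split_ifs <;> omega
  · rw [ho.neg_one_pow, neg_one_mul]
    obtain ⟨k, hk⟩ := ho
    rcases lt_or_gt_of_ne hlc with h | h
    · rw [if_neg (not_lt.2 h.le), if_pos (neg_pos.2 h), if_neg (not_lt.2 h.le), if_pos h]
      omega
    · rw [if_pos h, if_neg (not_lt.2 (neg_nonpos.2 h.le)), if_pos h, if_neg (not_lt.2 h.le)]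
      omega

end Count

/-! ### Local degrees and local inequalities for rational matrices -/

section Places

open Module

variable {K : Type*} [Field K] [Algebra ℝ K]

/-- The largest pole order at `0` of the images of the minors of `H` under `φ`. -/
def localDegree (φ : RatFunc ℝ →+* RatFunc K) {m n : ℕ}
    (H : Matrix (Fin m) (Fin n) (RatFunc ℝ)) : ℕ :=
  (Finset.univ : Finset (MinorIndex m n)).sup fun s =>
    poleOrder (laurentExpansion K (φ (minor H s)))

-- A minor of size at most `m` realizes at least the sum. Only this direction is needed for `H` and
-- for `SᵀHS`; for `SᵀH` it is the opposite bound, by a rank, that is used.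
omit [Algebra ℝ K] in
theorem sum_poleOrder_le_localDegree (φ : RatFunc ℝ →+* RatFunc K) {m : ℕ}
    {H : Matrix (Fin m) (Fin m) (RatFunc ℝ)}
    {b : Basis (Fin m) (PowerSeries K) (Fin m → PowerSeries K)}
    (hb : IsOrthogonalBasis ((H.map φ).map (laurentExpansion K)) b) :
    ∑ i, poleOrder (pairing ((H.map φ).map (laurentExpansion K)) (b i) (b i)) ≤
      localDegree φ H := by
  obtain ⟨k, hk, f, g, hfg⟩ := exists_sum_poleOrder_le _ hb
  refine hfg.trans ?_
  have h1 : (((H.map φ).map (laurentExpansion K)).submatrix f g).det =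
      laurentExpansion K (φ (minor H ⟨⟨k, by rw [min_self]; omega⟩, f, g⟩)) := by
    rw [minor, RingHom.map_det, RingHom.map_det]
    rfl
  rw [h1]
  exact Finset.le_sup (f := fun s => poleOrder (laurentExpansion K (φ (minor H s))))
    (Finset.mem_univ _)

/-- The constant matrix `S` over the power series ring. -/
def constPowerSeries (K : Type*) [Field K] [Algebra ℝ K] {m n : ℕ} (S : Matrix (Fin m) (Fin n) ℝ) :
    Matrix (Fin m) (Fin n) (PowerSeries K) :=
  S.map fun a => PowerSeries.C (algebraMap ℝ K a)

omit [Algebra ℝ K] in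
theorem laurentExpansion_C (a : K) : laurentExpansion K (RatFunc.C a) =
    algebraMap (PowerSeries K) (LaurentSeries K) (PowerSeries.C a) := by
  rw [← RatFunc.algebraMap_C, laurentExpansion_polynomial, Polynomial.coe_C]

variable {φ : RatFunc ℝ →+* RatFunc K}

theorem map_const (hφ : ∀ a, φ (RatFunc.C a) = RatFunc.C (algebraMap ℝ K a)) {m n : ℕ}
    (S : Matrix (Fin m) (Fin n) ℝ) : ((const S).map φ).map (laurentExpansion K) =
      (constPowerSeries K S).map (algebraMap (PowerSeries K) (LaurentSeries K)) := by
  refine Matrix.ext fun i j => ?_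
  simp only [const, constPowerSeries, Matrix.map_apply, hφ]
  exact laurentExpansion_C _

theorem map_transpose_const_mul (hφ : ∀ a, φ (RatFunc.C a) = RatFunc.C (algebraMap ℝ K a))
    {m n k : ℕ} (S : Matrix (Fin m) (Fin n) ℝ) (H : Matrix (Fin m) (Fin k) (RatFunc ℝ)) :
    (((const S)ᵀ * H).map φ).map (laurentExpansion K) =
      ((constPowerSeries K S).map (algebraMap (PowerSeries K) (LaurentSeries K)))ᵀ *
        (H.map φ).map (laurentExpansion K) := by
  rw [← map_const hφ, Matrix.map_mul, Matrix.map_mul]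
  rfl

theorem map_congruence_const (hφ : ∀ a, φ (RatFunc.C a) = RatFunc.C (algebraMap ℝ K a))
    {m n : ℕ} (S : Matrix (Fin m) (Fin n) ℝ) (H : Matrix (Fin m) (Fin m) (RatFunc ℝ)) :
    (((const S)ᵀ * H * const S).map φ).map (laurentExpansion K) =
      ((constPowerSeries K S).map (algebraMap (PowerSeries K) (LaurentSeries K)))ᵀ *
        (H.map φ).map (laurentExpansion K) *
        (constPowerSeries K S).map (algebraMap (PowerSeries K) (LaurentSeries K)) := by
  rw [Matrix.map_mul, Matrix.map_mul, map_const hφ, map_transpose_const_mul hφ]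

theorem localDegree_transpose_const_mul_le
    (hφ : ∀ a, φ (RatFunc.C a) = RatFunc.C (algebraMap ℝ K a))
    {m n N : ℕ} (S : Matrix (Fin m) (Fin n) ℝ) (H : Matrix (Fin m) (Fin m) (RatFunc ℝ))
    (h : ∀ (k : ℕ) (r : Fin k → Fin n) (s : Fin k → Fin m),
      poleOrder ((((constPowerSeries K S).map (algebraMap (PowerSeries K) (LaurentSeries K)))ᵀ *
        (H.map φ).map (laurentExpansion K)).submatrix r s).det ≤ N) :
    localDegree φ ((const S)ᵀ * H) ≤ N := by
  refine Finset.sup_le fun ⟨k, r, s⟩ _ => ?_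
  refine le_of_eq_of_le ?_ (h k r s)
  rw [← map_transpose_const_mul hφ, minor, RingHom.map_det, RingHom.map_det]
  rfl

/-- Meant for the complex places outside the real set under consideration: no order on `K` is
required, and no jumps occur in it. -/
theorem two_mul_localDegree_le (h2 : (2 : K) ≠ 0)
    (hφ : ∀ a, φ (RatFunc.C a) = RatFunc.C (algebraMap ℝ K a)) {m n : ℕ}
    (S : Matrix (Fin m) (Fin n) ℝ) {H : Matrix (Fin m) (Fin m) (RatFunc ℝ)} (hH : H.IsSymm) :
    2 * localDegree φ ((const S)ᵀ * H) ≤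
      localDegree φ H + localDegree φ ((const S)ᵀ * H * const S) := by
  have hs : ((H.map φ).map (laurentExpansion K)).IsSymm := (hH.map φ).map _
  have hs' : ((((const S)ᵀ * H * const S).map φ).map (laurentExpansion K)).IsSymm :=
    ((isSymm_congruence hH S).map φ).map _
  obtain ⟨b, hb⟩ := exists_isOrthogonalBasis h2 hs
  obtain ⟨c, hc⟩ := exists_isOrthogonalBasis h2 hs'
  have h3 := sum_poleOrder_le_localDegree φ hb
  have h4 := sum_poleOrder_le_localDegree φ hc
  rw [map_congruence_const hφ] at hc h4
  -- The local degree is a supremum, so the bound on `2 * poleOrder` is halved before it is passed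
  -- to all minors; rounding down loses nothing for natural numbers.
  have h5 : localDegree φ ((const S)ᵀ * H) ≤
      (localDegree φ H + localDegree φ ((const S)ᵀ * H * const S)) / 2 :=
    localDegree_transpose_const_mul_le hφ S H fun k r s => by
      have := two_mul_poleOrder_minor_le hs hb hc r s
      omega
  omega

/-- The two local inequalities at a real place. -/
theorem localDegree_netJumps_le {φ : RatFunc ℝ →+* RatFunc ℝ}
    (hφ : ∀ a, φ (RatFunc.C a) = RatFunc.C a) {m n : ℕ}
    (S : Matrix (Fin m) (Fin n) ℝ) {H : Matrix (Fin m) (Fin m) (RatFunc ℝ)} (hH : H.IsSymm) :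
    2 * (localDegree φ ((const S)ᵀ * H) : ℤ) ≤
      netJumps (H.map φ) (hH.map φ) (𝓝[<] 0) (𝓝[>] 0) + localDegree φ H -
      netJumps (((const S)ᵀ * H * const S).map φ) ((isSymm_congruence hH S).map φ)
        (𝓝[<] 0) (𝓝[>] 0) + localDegree φ ((const S)ᵀ * H * const S) ∧
    2 * (localDegree φ ((const S)ᵀ * H) : ℤ) ≤
      -netJumps (H.map φ) (hH.map φ) (𝓝[<] 0) (𝓝[>] 0) + localDegree φ H +
      netJumps (((const S)ᵀ * H * const S).map φ) ((isSymm_congruence hH S).map φ)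
        (𝓝[<] 0) (𝓝[>] 0) + localDegree φ ((const S)ᵀ * H * const S) := by
  have hs : ((H.map φ).map (laurentExpansion ℝ)).IsSymm := (hH.map φ).map _
  have hs' : ((((const S)ᵀ * H * const S).map φ).map (laurentExpansion ℝ)).IsSymm :=
    ((isSymm_congruence hH S).map φ).map _
  obtain ⟨b, hb⟩ := exists_isOrthogonalBasis two_ne_zero hs
  obtain ⟨c, hc⟩ := exists_isOrthogonalBasis two_ne_zero hs'
  have h3 := sum_poleOrder_le_localDegree φ hb
  have h4 := sum_poleOrder_le_localDegree φ hc
  rw [netJumps_zero (hH.map φ) hb, netJumps_zero ((isSymm_congruence hH S).map φ) hc]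
  rw [map_congruence_const hφ] at hc h4 ⊢
  simp only [← posIndex_add_negIndex, Finset.sum_add_distrib] at h3 h4
  have h5 := localDegree_transpose_const_mul_le hφ S H fun k r s =>
    poleOrder_minor_le_posIndex_add_negIndex hs hb hc r s
  have h6 := localDegree_transpose_const_mul_le hφ S H fun k r s =>
    poleOrder_minor_le_negIndex_add_posIndex hs hb hc r s
  zify at h3 h4 h5 h6
  constructor <;> linarith

/-- There are no net jumps at a regular point. -/
theorem netJumps_eq_zero_of_regular {m : ℕ} {H : Matrix (Fin m) (Fin m) (RatFunc ℝ)}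
    (hH : H.IsSymm) (h : ∀ i j, poleOrder (laurentExpansion ℝ (H i j)) = 0) :
    netJumps H hH (𝓝[<] 0) (𝓝[>] 0) = 0 := by
  have hs : (H.map (laurentExpansion ℝ)).IsSymm := hH.map _
  obtain ⟨b, hb⟩ := exists_isOrthogonalBasis two_ne_zero hs
  rw [netJumps_zero hH hb]
  have h1 : ∀ i, poleOrder (pairing (H.map (laurentExpansion ℝ)) (b i) (b i)) = 0 := fun i => by
    rw [← Nat.le_zero, ← mem_polesLE_iff, pairing_apply]
    exact Submodule.sum_mem _ fun i _ => Submodule.smul_mem _ _ (Submodule.sum_mem _ fun j _ =>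
      Submodule.smul_mem _ _ (mem_polesLE_iff.2 (h i j).le))
  simp [posIndex, negIndex, h1]

theorem eigenvalue_congr {m : ℕ} {A B : Matrix (Fin m) (Fin m) ℝ} (h : A = B) (hA : A.IsHermitian)
    (hB : B.IsHermitian) (i : Fin (Fintype.card (Fin m))) :
    hA.eigenvalues₀ i = hB.eigenvalues₀ i := by
  subst h; rfl

theorem countToTop_map {φ : RatFunc ℝ →+* RatFunc ℝ} {θ : ℝ → ℝ} {l : Filter ℝ}
    (h : ∀ f, ∀ᶠ s in l, (φ f).eval (RingHom.id ℝ) s = f.eval (RingHom.id ℝ) (θ s)) {m : ℕ}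
    {H : Matrix (Fin m) (Fin m) (RatFunc ℝ)} (hH : H.IsSymm) :
    countToTop H hH (map θ l) = countToTop (H.map φ) (hH.map φ) l := by
  have h1 : ∀ᶠ s in l, evalAt (H.map φ) s = evalAt H (θ s) := by
    filter_upwards [eventually_all.2 fun i => eventually_all.2 fun j => h (H i j)] with s hs
    exact Matrix.ext hs
  unfold countToTop
  congr 1
  ext i
  simp only [Finset.mem_filter, Finset.mem_univ, true_and]
  rw [tendsto_map'_iff]
  exact tendsto_congr' (h1.mono fun s hs =>
    (eigenvalue_congr hs _ (isHermitian_evalAt hH (θ s)) i).symm)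

theorem netJumps_map {φ : RatFunc ℝ →+* RatFunc ℝ} {θ : ℝ → ℝ} {l l' : Filter ℝ}
    (h : ∀ f, ∀ᶠ s in l, (φ f).eval (RingHom.id ℝ) s = f.eval (RingHom.id ℝ) (θ s))
    (hl : ∀ f, ∀ᶠ s in l', (φ f).eval (RingHom.id ℝ) s = f.eval (RingHom.id ℝ) (θ s)) {m : ℕ}
    {H : Matrix (Fin m) (Fin m) (RatFunc ℝ)} (hH : H.IsSymm) :
    netJumps H hH (map θ l) (map θ l') = netJumps (H.map φ) (hH.map φ) l l' := by
  rw [netJumps, netJumps, countToTop_map h, countToTop_map hl]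

/-- It suffices to check the compatibility of `φ` with a substitution on polynomials. -/
theorem eventually_eval_eq_of_polynomial {φ : RatFunc ℝ →+* RatFunc ℝ} {θ : ℝ → ℝ} {l : Filter ℝ}
    (hl : l ≤ cofinite) (hθ : map θ l ≤ cofinite)
    (h : ∀ p : ℝ[X], ∀ᶠ s in l,
      (φ (algebraMap ℝ[X] (RatFunc ℝ) p)).eval (RingHom.id ℝ) s = p.eval (θ s)) (f : RatFunc ℝ) :
    ∀ᶠ s in l, (φ f).eval (RingHom.id ℝ) s = f.eval (RingHom.id ℝ) (θ s) := by
  have h1 := RatFunc.num_div_denom f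
  rw [div_eq_iff (RatFunc.algebraMap_ne_zero f.denom_ne_zero)] at h1
  have h2 := congrArg φ h1
  rw [map_mul] at h2
  filter_upwards [h f.num, h f.denom, eventually_eval_mul hl (φ f)
    (φ (algebraMap ℝ[X] (RatFunc ℝ) f.denom)),
    eventually_map.1 (eventually_eval_ne_zero hθ f.denom_ne_zero)] with s h3 h4 h5 h6
  rw [← h2, h3, h4] at h5
  exact eq_div_of_mul_eq h6 h5.symm

/-! ### Finite places -/

section Finite

theorem finitePlace_aux (z : K) : Function.Injective
    ((algebraMap K[X] (RatFunc K)).comp (((taylorAlgHom z : K[X] →ₐ[K] K[X]) : K[X] →+* K[X]).comp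
      (mapRingHom (algebraMap ℝ K)))) :=
  (RatFunc.algebraMap_injective K).comp ((taylor_injective z).comp
    (Polynomial.map_injective _ (algebraMap ℝ K).injective))

/-- The substitution of `z + t` for the variable. -/
def finitePlace (z : K) : RatFunc ℝ →+* RatFunc K :=
  RatFunc.liftRingHom _ (le_comap_nonZeroDivisors (finitePlace_aux z))

theorem finitePlace_polynomial (z : K) (p : ℝ[X]) :
    finitePlace z (algebraMap ℝ[X] (RatFunc ℝ) p) =
      algebraMap K[X] (RatFunc K) (taylor z (p.map (algebraMap ℝ K))) :=
  RatFunc.liftRingHom_algebraMap _ _ _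

theorem finitePlace_C (z : K) (a : ℝ) :
    finitePlace z (RatFunc.C a) = RatFunc.C (algebraMap ℝ K a) := by
  rw [← RatFunc.algebraMap_C, finitePlace_polynomial, Polynomial.map_C, taylor_C,
    RatFunc.algebraMap_C]

omit [Algebra ℝ K] in
theorem exists_taylor_eq (z : K) {p : K[X]} (hp : p ≠ 0) :
    ∃ p' : K[X], p'.eval 0 ≠ 0 ∧ taylor z p = X ^ p.rootMultiplicity z * p' := by
  obtain ⟨q, hq, hq'⟩ := p.exists_eq_pow_rootMultiplicity_mul_and_not_dvd hp z
  refine ⟨taylor z q, ?_, ?_⟩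
  · rw [taylor_eval, zero_add]
    rwa [dvd_iff_isRoot] at hq'
  · conv_lhs => rw [hq]
    rw [taylor_mul, taylor_pow]
    simp

/-- After the shift by `z` the order is the difference of the multiplicities of `z` in numerator and
denominator. These remain coprime over `K`, so one of the two multiplicities is zero. -/
theorem poleOrder_finitePlace (z : K) (f : RatFunc ℝ) :
    poleOrder (laurentExpansion K (finitePlace z f)) =
      (f.denom.map (algebraMap ℝ K)).rootMultiplicity z := by
  by_cases hf : f = 0
  · rw [hf, map_zero, map_zero, poleOrder_zero, RatFunc.denom_zero, Polynomial.map_one,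
      ← C_1, rootMultiplicity_C]
  have hn : f.num.map (algebraMap ℝ K) ≠ 0 :=
    (Polynomial.map_ne_zero_iff (algebraMap ℝ K).injective).2 (RatFunc.num_ne_zero hf)
  have hd : f.denom.map (algebraMap ℝ K) ≠ 0 :=
    (Polynomial.map_ne_zero_iff (algebraMap ℝ K).injective).2 f.denom_ne_zero
  obtain ⟨p, hp, hp'⟩ := exists_taylor_eq z hn
  obtain ⟨q, hq, hq'⟩ := exists_taylor_eq z hd
  have h1 := RatFunc.num_div_denom f
  rw [div_eq_iff (RatFunc.algebraMap_ne_zero f.denom_ne_zero)] at h1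
  have h2 := congrArg (finitePlace z) h1
  rw [map_mul, finitePlace_polynomial, finitePlace_polynomial, hp', hq', map_mul, map_mul, map_pow,
    map_pow, RatFunc.algebraMap_X] at h2
  have h3 := (order_leadingCoeff_of_mul_eq hp hq h2.symm).1
  have hc : IsCoprime (f.num.map (algebraMap ℝ K)) (f.denom.map (algebraMap ℝ K)) :=
    f.isCoprime_num_denom.map (mapRingHom (algebraMap ℝ K))
  have h4 : (f.num.map (algebraMap ℝ K)).rootMultiplicity z = 0 ∨
      (f.denom.map (algebraMap ℝ K)).rootMultiplicity z = 0 := by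
    by_contra hcon
    push Not at hcon
    have r1 := (rootMultiplicity_pos hn).1 (Nat.pos_of_ne_zero hcon.1)
    have r2 := (rootMultiplicity_pos hd).1 (Nat.pos_of_ne_zero hcon.2)
    obtain ⟨u, v, huv⟩ := hc
    have := congrArg (eval z) huv
    rw [eval_add, eval_mul, eval_mul, r1.eq_zero, r2.eq_zero] at this
    simp at this
  unfold poleOrder
  omega

theorem eventually_eval_finitePlace {l : Filter ℝ} (hl : l ≤ cofinite) (p : ℝ) (f : RatFunc ℝ) :
    ∀ᶠ s in l, (finitePlace p f).eval (RingHom.id ℝ) s = f.eval (RingHom.id ℝ) (s + p) := by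
  refine eventually_eval_eq_of_polynomial hl ?_ (fun q => Eventually.of_forall fun s => ?_) f
  · exact ((add_left_injective p).tendsto_cofinite).mono_left hl
  · rw [finitePlace_polynomial, eval_polynomial, taylor_eval, Algebra.algebraMap_self,
      Polynomial.map_id]

theorem netJumps_eq_finitePlace (p : ℝ) {m : ℕ} {H : Matrix (Fin m) (Fin m) (RatFunc ℝ)}
    (hH : H.IsSymm) : netJumps H hH (𝓝[<] p) (𝓝[>] p) =
      netJumps (H.map (finitePlace p)) (hH.map (finitePlace p)) (𝓝[<] 0) (𝓝[>] 0) := by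
  rw [← netJumps_map (θ := fun s => s + p)
    (eventually_eval_finitePlace isSide_left.le_cofinite p)
    (eventually_eval_finitePlace isSide_right.le_cofinite p) hH]
  rw [map_add_right_nhdsLT, map_add_right_nhdsGT, zero_add]

end Finite

/-! ### The place at infinity -/

section Infinite

/-- Clearing denominators in `p(-1/t)` leaves the reversed polynomial at `-t`, up to sign. Its value
at `0` is, up to sign, the leading coefficient of `p`, so the order at the new origin is minus the
degree. -/
theorem eval₂_neg_inv_X_mul_pow (p : ℝ[X]) :
    eval₂ RatFunc.C (-(RatFunc.X : RatFunc ℝ)⁻¹) p * RatFunc.X ^ p.natDegree =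
      algebraMap ℝ[X] (RatFunc ℝ) (p.reverse.comp (-X) * C ((-1) ^ p.natDegree)) := by
  have hX : (RatFunc.X : RatFunc ℝ) ≠ 0 := RatFunc.X_ne_zero
  have := invertibleOfNonzero (neg_ne_zero.2 (inv_ne_zero hX))
  rw [← eval₂_reverse_mul_pow RatFunc.C (-(RatFunc.X : RatFunc ℝ)⁻¹) p, invOf_eq_inv, mul_assoc,
    ← mul_pow, neg_mul, inv_mul_cancel₀ hX, map_mul, RatFunc.algebraMap_C, map_pow, map_neg,
    map_one, inv_neg, inv_inv]
  congr 1
  rw [Polynomial.comp, hom_eval₂, RatFunc.algebraMap_comp_C, map_neg, RatFunc.algebraMap_X]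

theorem eval_zero_reverse_ne_zero {p : ℝ[X]} (hp : p ≠ 0) :
    (p.reverse.comp (-X) * C ((-1) ^ p.natDegree)).eval 0 ≠ 0 := by
  rw [eval_mul, eval_comp, eval_neg, eval_X, neg_zero, eval_C, ← coeff_zero_eq_eval_zero,
    coeff_zero_reverse]
  exact mul_ne_zero (leadingCoeff_ne_zero.2 hp) (pow_ne_zero _ (by norm_num))

theorem infinitePlace_aux :
    Function.Injective (eval₂RingHom RatFunc.C (-(RatFunc.X : RatFunc ℝ)⁻¹)) := by
  rw [injective_iff_map_eq_zero]
  intro p hp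
  by_contra h0
  have h1 := eval₂_neg_inv_X_mul_pow p
  rw [coe_eval₂RingHom] at hp
  rw [hp, zero_mul] at h1
  have h2 := (map_eq_zero_iff _ (RatFunc.algebraMap_injective ℝ)).1 h1.symm
  have h3 := eval_zero_reverse_ne_zero h0
  rw [h2, eval_zero] at h3
  exact h3 rfl

/-- The substitution of `-1 / t` for the variable. -/
def infinitePlace : RatFunc ℝ →+* RatFunc ℝ :=
  RatFunc.liftRingHom _ (le_comap_nonZeroDivisors infinitePlace_aux)

theorem infinitePlace_polynomial_mul (p : ℝ[X]) :
    infinitePlace (algebraMap ℝ[X] (RatFunc ℝ) p) * RatFunc.X ^ p.natDegree =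
      algebraMap ℝ[X] (RatFunc ℝ) (p.reverse.comp (-X) * C ((-1) ^ p.natDegree)) := by
  rw [← eval₂_neg_inv_X_mul_pow]
  congr 1
  exact RatFunc.liftRingHom_algebraMap _ _ _

theorem infinitePlace_C (a : ℝ) : infinitePlace (RatFunc.C a) = RatFunc.C a := by
  rw [← RatFunc.algebraMap_C]
  refine (RatFunc.liftRingHom_algebraMap _ _ _).trans ?_
  rw [coe_eval₂RingHom, eval₂_C, RatFunc.algebraMap_C]

theorem poleOrder_infinitePlace (f : RatFunc ℝ) :
    poleOrder (laurentExpansion ℝ (infinitePlace f)) = f.intDegree.toNat := by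
  by_cases hf : f = 0
  · simp [hf]
  have h1 := RatFunc.num_div_denom f
  rw [div_eq_iff (RatFunc.algebraMap_ne_zero f.denom_ne_zero)] at h1
  have h2 := congrArg infinitePlace h1
  rw [map_mul] at h2
  have h3 : infinitePlace f * (RatFunc.X ^ f.num.natDegree *
      algebraMap ℝ[X] (RatFunc ℝ)
        (f.denom.reverse.comp (-X) * C ((-1) ^ f.denom.natDegree))) =
      RatFunc.X ^ f.denom.natDegree * algebraMap ℝ[X] (RatFunc ℝ)
        (f.num.reverse.comp (-X) * C ((-1) ^ f.num.natDegree)) := by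
    rw [← infinitePlace_polynomial_mul, ← infinitePlace_polynomial_mul, h2]
    ring
  have h4 := (order_leadingCoeff_of_mul_eq (eval_zero_reverse_ne_zero (RatFunc.num_ne_zero hf))
    (eval_zero_reverse_ne_zero f.denom_ne_zero) h3).1
  unfold poleOrder RatFunc.intDegree
  rw [h4]
  congr 1
  ring

theorem eventually_eval_infinitePlace {l : Filter ℝ} {ε : ℝ} (hl : IsSide l ε) (f : RatFunc ℝ) :
    ∀ᶠ s in l, (infinitePlace f).eval (RingHom.id ℝ) s = f.eval (RingHom.id ℝ) (-s⁻¹) := by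
  refine eventually_eval_eq_of_polynomial hl.le_cofinite ?_ (fun p => ?_) f
  · have : Function.Injective fun s : ℝ => -s⁻¹ := fun a b h => inv_injective (neg_injective h)
    exact this.tendsto_cofinite.mono_left hl.le_cofinite
  · filter_upwards [eventually_eval_mul hl.le_cofinite
      (infinitePlace (algebraMap ℝ[X] (RatFunc ℝ) p)) (RatFunc.X ^ p.natDegree),
      hl.eventually_ne] with s h1 h2
    rw [infinitePlace_polynomial_mul, eval_polynomial, ← RatFunc.algebraMap_X, ← map_pow,
      eval_polynomial, eval_pow, eval_X, eval_mul, eval_comp, eval_C, eval_neg, eval_X] at h1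
    have := invertibleOfNonzero (neg_ne_zero.2 (inv_ne_zero h2))
    have h3 := eval₂_reverse_mul_pow (RingHom.id ℝ) (-s⁻¹) p
    rw [invOf_eq_inv, inv_neg, inv_inv] at h3
    change eval (-s) p.reverse * _ = eval _ p at h3
    rw [← h3]
    refine mul_right_cancel₀ (pow_ne_zero p.natDegree h2) ?_
    rw [← h1, mul_assoc, ← mul_pow, neg_mul, inv_mul_cancel₀ h2]

theorem map_neg_inv_nhdsLT_zero : map (fun s : ℝ => -s⁻¹) (𝓝[<] 0) = atTop := by
  refine map_eq_of_inverse (fun s => -s⁻¹) (by ext; simp) ?_ ?_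
  · exact tendsto_neg_atBot_atTop.comp tendsto_inv_nhdsLT_zero
  · have := tendsto_inv_atTop_nhdsGT_zero (𝕜 := ℝ)
    simpa [Function.comp_def] using (tendsto_neg_nhdsGT (a := (0 : ℝ))).comp this

theorem map_neg_inv_nhdsGT_zero : map (fun s : ℝ => -s⁻¹) (𝓝[>] 0) = atBot := by
  refine map_eq_of_inverse (fun s => -s⁻¹) (by ext; simp) ?_ ?_
  · exact tendsto_neg_atTop_atBot.comp tendsto_inv_nhdsGT_zero
  · have := tendsto_inv_atBot_nhdsLT_zero (𝕜 := ℝ)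
    simpa [Function.comp_def] using (tendsto_neg_nhdsLT (a := (0 : ℝ))).comp this

/-- The minus sign in `-1/t` keeps the orientation: `t` increasing through `0` corresponds to
passing from `+∞` to `-∞`. -/
theorem netJumps_eq_infinitePlace {m : ℕ} {H : Matrix (Fin m) (Fin m) (RatFunc ℝ)}
    (hH : H.IsSymm) : netJumps H hH atTop atBot =
      netJumps (H.map infinitePlace) (hH.map infinitePlace) (𝓝[<] 0) (𝓝[>] 0) := by
  rw [← netJumps_map (θ := fun s => -s⁻¹) (eventually_eval_infinitePlace isSide_left)
    (eventually_eval_infinitePlace isSide_right) hH]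
  rw [map_neg_inv_nhdsLT_zero, map_neg_inv_nhdsGT_zero]

theorem poleMultiplicityInfty_eq {m n : ℕ} (H : Matrix (Fin m) (Fin n) (RatFunc ℝ)) :
    poleMultiplicityInfty H = localDegree infinitePlace H := by
  simp only [poleMultiplicityInfty, localDegree, poleOrder_infinitePlace]

end Infinite

end Places

/-! ### The McMillan degree as a sum of local degrees -/

section Degree

variable {K : Type*} [Field K] [Algebra ℝ K]

theorem rootMultiplicity_map_mul {p q : ℝ[X]} (hp : p ≠ 0) (hq : q ≠ 0) (z : K) :
    ((p * q).map (algebraMap ℝ K)).rootMultiplicity z =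
      (p.map (algebraMap ℝ K)).rootMultiplicity z +
        (q.map (algebraMap ℝ K)).rootMultiplicity z := by
  rw [Polynomial.map_mul, rootMultiplicity_mul]
  exact mul_ne_zero ((Polynomial.map_ne_zero_iff (algebraMap ℝ K).injective).2 hp)
    ((Polynomial.map_ne_zero_iff (algebraMap ℝ K).injective).2 hq)

theorem rootMultiplicity_map_le_of_dvd {p q : ℝ[X]} (hq : q ≠ 0) (h : p ∣ q) (z : K) :
    (p.map (algebraMap ℝ K)).rootMultiplicity z ≤
      (q.map (algebraMap ℝ K)).rootMultiplicity z := by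
  exact rootMultiplicity_le_rootMultiplicity_of_dvd
    ((Polynomial.map_ne_zero_iff (algebraMap ℝ K).injective).2 hq)
    (Polynomial.map_dvd _ h) z

theorem min_rootMultiplicity_map_le_gcd [GCDMonoid ℝ[X]] {p q : ℝ[X]} (hp : p ≠ 0) (z : K) :
    min ((p.map (algebraMap ℝ K)).rootMultiplicity z)
      ((q.map (algebraMap ℝ K)).rootMultiplicity z) ≤
      ((gcd p q).map (algebraMap ℝ K)).rootMultiplicity z := by
  have h0 : gcd p q ≠ 0 := fun h => hp (by simpa [h] using gcd_dvd_left p q)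
  -- The Euclidean gcd comes with a Bézout identity, which survives the base change to `K`, where
  -- `p` and `q` may acquire new roots.
  have h1 : EuclideanDomain.gcd p q ∣ gcd p q :=
    dvd_gcd (EuclideanDomain.gcd_dvd_left p q) (EuclideanDomain.gcd_dvd_right p q)
  refine le_trans ?_ (rootMultiplicity_map_le_of_dvd h0 h1 z)
  rw [le_rootMultiplicity_iff ((Polynomial.map_ne_zero_iff (algebraMap ℝ K).injective).2
    (ne_zero_of_dvd_ne_zero h0 h1)), EuclideanDomain.gcd_eq_gcd_ab, Polynomial.map_add,
    Polynomial.map_mul, Polynomial.map_mul]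
  exact dvd_add
    (((pow_dvd_pow _ (min_le_left _ _)).trans (pow_rootMultiplicity_dvd _ z)).mul_right _)
    (((pow_dvd_pow _ (min_le_right _ _)).trans (pow_rootMultiplicity_dvd _ z)).mul_right _)

/-- The product of gcd and lcm is associated to `p * q`, and the gcd already carries the minimum of
the multiplicities, so at most the maximum is left for the lcm. -/
theorem rootMultiplicity_map_lcm [G : GCDMonoid ℝ[X]] {p q : ℝ[X]} (hp : p ≠ 0) (hq : q ≠ 0)
    (z : K) : ((lcm p q).map (algebraMap ℝ K)).rootMultiplicity z =
      max ((p.map (algebraMap ℝ K)).rootMultiplicity z)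
        ((q.map (algebraMap ℝ K)).rootMultiplicity z) := by
  have h0 : gcd p q ≠ 0 := fun h => hp (by simpa [h] using gcd_dvd_left p q)
  have h1 : lcm p q ≠ 0 := lcm_ne_zero_iff.2 ⟨hp, hq⟩
  have h2 := rootMultiplicity_map_le_of_dvd (mul_ne_zero hp hq) (gcd_mul_lcm p q).dvd z
  rw [rootMultiplicity_map_mul h0 h1, rootMultiplicity_map_mul hp hq] at h2
  have h3 := min_rootMultiplicity_map_le_gcd (q := q) hp z
  have h4 := rootMultiplicity_map_le_of_dvd h1 (dvd_lcm_left p q) z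
  have h5 := rootMultiplicity_map_le_of_dvd h1 (dvd_lcm_right p q) z
  omega

theorem finset_lcm_ne_zero [NormalizedGCDMonoid ℝ[X]] {ι : Type*} (s : Finset ι) {g : ι → ℝ[X]}
    (hg : ∀ i, g i ≠ 0) : s.lcm g ≠ 0 := by
  rw [Ne, Finset.lcm_eq_zero_iff]
  rintro ⟨i, -, hi⟩
  exact hg i hi

theorem rootMultiplicity_map_finset_lcm [N : NormalizedGCDMonoid ℝ[X]] {ι : Type*}
    (s : Finset ι) {g : ι → ℝ[X]} (hg : ∀ i, g i ≠ 0) (z : K) :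
    ((s.lcm g).map (algebraMap ℝ K)).rootMultiplicity z =
      s.sup fun i => ((g i).map (algebraMap ℝ K)).rootMultiplicity z := by
  classical
  induction s using Finset.induction_on with
  | empty => rw [Finset.lcm_empty, Polynomial.map_one, ← C_1, rootMultiplicity_C]; rfl
  | insert i s _ ih =>
    rw [Finset.lcm_insert, Finset.sup_insert, ← ih]
    exact rootMultiplicity_map_lcm (G := N.toGCDMonoid) (hg i) (finset_lcm_ne_zero s hg) z

theorem rootMultiplicity_polePolynomial {m n : ℕ} (H : Matrix (Fin m) (Fin n) (RatFunc ℝ))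
    (z : K) : ((polePolynomial H).map (algebraMap ℝ K)).rootMultiplicity z =
      localDegree (finitePlace z) H := by
  let _ : NormalizedGCDMonoid ℝ[X] := UniqueFactorizationMonoid.toNormalizedGCDMonoid ℝ[X]
  simp only [localDegree, poleOrder_finitePlace]
  exact rootMultiplicity_map_finset_lcm _ (fun s => (minor H s).denom_ne_zero) z

/-- The degree count needs all places over `ℂ`, signatures need the real places over `ℝ`. Root
multiplicities of the pole polynomial do not change under the field extension, so the two
descriptions agree. -/
theorem localDegree_finitePlace_ofReal {m n : ℕ} (H : Matrix (Fin m) (Fin n) (RatFunc ℝ))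
    (p : ℝ) : localDegree (finitePlace (p : ℂ)) H = localDegree (finitePlace p) H := by
  rw [← rootMultiplicity_polePolynomial, ← rootMultiplicity_polePolynomial,
    Algebra.algebraMap_self, Polynomial.map_id]
  exact (eq_rootMultiplicity_map (algebraMap ℝ ℂ).injective p).symm

theorem natDegree_polePolynomial {m n : ℕ} (H : Matrix (Fin m) (Fin n) (RatFunc ℝ))
    {Z : Finset ℂ} (hZ : ((polePolynomial H).map (algebraMap ℝ ℂ)).roots.toFinset ⊆ Z) :
    (polePolynomial H).natDegree = ∑ z ∈ Z, localDegree (finitePlace z) H := by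
  rw [← natDegree_map (algebraMap ℝ ℂ), (IsAlgClosed.splits _).natDegree_eq_card_roots,
    ← Multiset.sum_count_eq_card (s := Z) fun z hz => hZ (Multiset.mem_toFinset.2 hz)]
  refine Finset.sum_congr rfl fun z _ => ?_
  rw [count_roots, rootMultiplicity_polePolynomial]

end Degree

/-! ### Global sums over places and the final inequalities -/

theorem netJumps_eq_zero_of_notMem_realPoles {m : ℕ} {H : Matrix (Fin m) (Fin m) (RatFunc ℝ)}
    (hH : H.IsSymm) {p : ℝ} (hp : p ∉ realPoles H) : netJumps H hH (𝓝[<] p) (𝓝[>] p) = 0 := by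
  rw [netJumps_eq_finitePlace]
  refine netJumps_eq_zero_of_regular _ fun i j => ?_
  rw [Matrix.map_apply, poleOrder_finitePlace, Algebra.algebraMap_self, Polynomial.map_id]
  refine rootMultiplicity_eq_zero fun h => hp ?_
  simp only [realPoles, Finset.mem_biUnion, Finset.mem_univ, true_and, Multiset.mem_toFinset]
  exact ⟨i, j, (mem_roots (H i j).denom_ne_zero).2 h⟩

/-- Points that are not poles contribute zero, so the set of real points may be enlarged. This
allows one common set for `H` and `SᵀHS`. -/
theorem extendedCauchyIndex_eq_sum {m : ℕ} {H : Matrix (Fin m) (Fin m) (RatFunc ℝ)}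
    (hH : H.IsSymm) {P : Finset ℝ} (hP : realPoles H ⊆ P) : extendedCauchyIndex H hH =
      ∑ p ∈ P, netJumps (H.map (finitePlace p)) (hH.map (finitePlace p)) (𝓝[<] 0) (𝓝[>] 0) +
      netJumps (H.map infinitePlace) (hH.map infinitePlace) (𝓝[<] 0) (𝓝[>] 0) := by
  rw [extendedCauchyIndex, Finset.sum_subset hP fun p _ hp =>
    netJumps_eq_zero_of_notMem_realPoles hH hp, netJumps_eq_infinitePlace,
    Finset.sum_congr rfl fun p _ => netJumps_eq_finitePlace p hH]

/-- The McMillan degree as the sum of the local degrees at the places in a finite set `P` of real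
numbers, at the remaining places in a finite set `Z` of complex numbers, and at infinity. -/
theorem mcMillanDegree_eq_sum {m n : ℕ} (H : Matrix (Fin m) (Fin n) (RatFunc ℝ)) {Z : Finset ℂ}
    {P : Finset ℝ} (hZ : ((polePolynomial H).map (algebraMap ℝ ℂ)).roots.toFinset ⊆
      Z ∪ P.image Complex.ofReal) :
    mcMillanDegree H = ∑ z ∈ Z \ P.image Complex.ofReal, localDegree (finitePlace z) H +
      ∑ p ∈ P, localDegree (finitePlace p) H + localDegree infinitePlace H := by
  rw [mcMillanDegree, poleMultiplicityInfty_eq, natDegree_polePolynomial H hZ,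
    ← Finset.sdiff_union_self_eq_union, Finset.sum_union Finset.sdiff_disjoint,
    Finset.sum_image Complex.ofReal_injective.injOn,
    Finset.sum_congr rfl fun p (_ : p ∈ P) => localDegree_finitePlace_ofReal H p]

end RealRational

end

theorem theorem13 {m n : ℕ} (H : Matrix (Fin m) (Fin m) (RatFunc ℝ)) (hH : H.IsSymm)
    (S : Matrix (Fin m) (Fin n) ℝ) :
    RealRational.extendedCauchyIndex H hH + (RealRational.mcMillanDegree H : ℤ) ≥
        RealRational.extendedCauchyIndex ((RealRational.const S)ᵀ * H * RealRational.const S)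
            (RealRational.isSymm_congruence hH S)
          - (RealRational.mcMillanDegree
              ((RealRational.const S)ᵀ * H * RealRational.const S) : ℤ)
          + 2 * (RealRational.mcMillanDegree ((RealRational.const S)ᵀ * H) : ℤ) ∧
      RealRational.extendedCauchyIndex H hH - (RealRational.mcMillanDegree H : ℤ) ≤
        RealRational.extendedCauchyIndex ((RealRational.const S)ᵀ * H * RealRational.const S)
            (RealRational.isSymm_congruence hH S)
          + (RealRational.mcMillanDegree
              ((RealRational.const S)ᵀ * H * RealRational.const S) : ℤ)
          - 2 * (RealRational.mcMillanDegree ((RealRational.const S)ᵀ * H) : ℤ) := by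
  classical
  have hK := RealRational.isSymm_congruence hH S
  set K := (RealRational.const S)ᵀ * H * RealRational.const S
  set G := (RealRational.const S)ᵀ * H
  -- Points of `P` are treated over `ℝ` with signs. All other roots of the three pole polynomials
  -- are treated over `ℂ`; jumps of `H` and of `SᵀHS` at finite points occur only in `P`.
  let P := RealRational.realPoles H ∪ RealRational.realPoles K
  let Z := ((RealRational.polePolynomial H).map (algebraMap ℝ ℂ)).roots.toFinset ∪
    ((RealRational.polePolynomial G).map (algebraMap ℝ ℂ)).roots.toFinset ∪
    ((RealRational.polePolynomial K).map (algebraMap ℝ ℂ)).roots.toFinset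
  rw [RealRational.extendedCauchyIndex_eq_sum hH (P := P) Finset.subset_union_left,
    RealRational.extendedCauchyIndex_eq_sum hK (P := P) Finset.subset_union_right,
    RealRational.mcMillanDegree_eq_sum H (Z := Z) (P := P)
      ((Finset.subset_union_left.trans Finset.subset_union_left).trans Finset.subset_union_left),
    RealRational.mcMillanDegree_eq_sum G (Z := Z) (P := P)
      ((Finset.subset_union_right.trans Finset.subset_union_left).trans Finset.subset_union_left),
    RealRational.mcMillanDegree_eq_sum K (Z := Z) (P := P)
      (Finset.subset_union_right.trans Finset.subset_union_left)]
  have h1 := Finset.sum_le_sum fun z (_ : z ∈ Z \ P.image Complex.ofReal) =>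
    RealRational.two_mul_localDegree_le two_ne_zero (RealRational.finitePlace_C z) S hH
  have h2 := Finset.sum_le_sum fun p (_ : p ∈ P) =>
    (RealRational.localDegree_netJumps_le (RealRational.finitePlace_C p) S hH).1
  have h3 := Finset.sum_le_sum fun p (_ : p ∈ P) =>
    (RealRational.localDegree_netJumps_le (RealRational.finitePlace_C p) S hH).2
  obtain ⟨h4, h5⟩ := RealRational.localDegree_netJumps_le RealRational.infinitePlace_C S hH
  simp only [Finset.sum_add_distrib, Finset.sum_sub_distrib, Finset.sum_neg_distrib,
    ← Finset.mul_sum] at h1 h2 h3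
  zify at h1
  push_cast
  constructor <;> linarith
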